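/- **Setting.** Let $m\ge 1$ and let $\Omega\subset\mathbb R^{m+1}$ be a domain. Let $a^{ij}(x,p)$ ($1\le i,j\le m+1$) be $C^\infty$ functions on $\Omega\times\mathbb R^{m+1}$ and $b(x,z,p)$ a $C^\infty$ function on $\Omega\times\mathbb R\times\mathbb R^{m+1}$ such that (1) $a^{ij}=a^{ji}$ and $(a^{ij})$ is nonnegative, i.e. $\sum_{i,j}a^{ij}(x,p)\xi_i\xi_j\ge 0$ for all $(x,p)\in\Omega\times\mathbb R^{m+1}$ and $\xi\in\mathbb R^{m+1}$; (2) $\partial b/\partial z\le 0$. For $C^\infty$ vector fields $X_1,\dots,X_r$ on $\Omega$ let $\mathcal L(X_1,\dots,X_r)$ be the smallest $C^\infty(\Omega)$-module of vector fields on $\Omega$ that contains $X_1,\dots,X_r$ and is closed under the Lie bracket. For a function $w$ on $\Omega$ we say that *maxima of $w$ propagate along $\mathcal L(X_1,\dots,X_r)$* if the following holds: whenever $\Gamma\subset\Omega$ is an integral curve of some $Z\in\mathcal L(X_1,\dots,X_r)$ and $w$ achieves a nonnegative maximum over $\Omega$ at a point of $\Gamma$, this maximum is attained at all points of $\Gamma$.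 Repeated indices $i,j$ are summed from $1$ to $m+1$. **Theorem A.** Let $Q\varphi=a^{ij}(x,D\varphi)D_{ij}\varphi+b(x,\varphi,D\varphi)$. Let $\varphi,\psi\in C^\infty(\Omega)$ satisfy $Q\varphi\ge Q\psi$ in $\Omega$, and let $X_1,\dots,X_r,Y$ be $C^\infty$ vector fields on $\Omega$ (which may depend on $\varphi$) such that $$(3)\qquad a^{ij}(x,D\varphi(x))\,D_{ij}=\sum_{k=1}^r X_k^2+Y$$ as differential operators on $\Omega$. Then maxima of $\varphi-\psi$ propagate along $\mathcal L(X_1,\dots,X_r)$. **Theorem A′.** Let $e_1,\dots,e_{m+1}$ be $C^\infty$ vector fields on $\Omega$, linearly independent at every point, and let $$Q'\varphi=a^{ij}(x,e_1\varphi,\dots,e_{m+1}\varphi)\,e_ie_j\varphi+b(x,\varphi,e_1\varphi,\dots,e_{m+1}\varphi).$$ Let $\varphi,\psi\in C^\infty(\Omega)$ satisfy $Q'\varphi\ge Q'\psi$ in $\Omega$, and let $X_1,\dots,X_r,Y$ be $C^\infty$ vector fields on $\Omega$ (which may depend on $\varphi$) such that $$(3')\qquad a^{ij}(x,e_1\varphi(x),\dots,e_{m+1}\varphi(x))\,e_ie_j=\sum_{k=1}^r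 X_k^2+Y$$ as differential operators on $\Omega$. Then maxima of $\varphi-\psi$ propagate along $\mathcal L(X_1,\dots,X_r)$. **Theorem Ã.** Theorem A (respectively A′) holds with condition (3) (respectively (3′)) replaced by the condition that the matrix $\tilde a^{ij}(x)=a^{ij}(x,D\varphi(x))$ (respectively $\tilde a^{ij}(x)=a^{ij}(x,e_1\varphi(x),\dots,e_{m+1}\varphi(x))$) has constant rank on $\Omega$. That is: if $\varphi\in C^\infty(\Omega)$ and $(\tilde a^{ij}(x))$ has constant rank on $\Omega$, then there exist $C^\infty$ vector fields $X_1,\dots,X_r,Y$ on $\Omega$ satisfying (3) (respectively (3′)) such that, for every $\psi\in C^\infty(\Omega)$ with $Q\varphi\ge Q\psi$ (respectively $Q'\varphi\ge Q'\psi$) in $\Omega$, maxima of $\varphi-\psi$ propagate along $\mathcal L(X_1,\dots,X_r)$. -/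

import Mathlib

open scoped ContDiff

/-- The action of a vector field `X` on a function `f`: `(X f)(x) = df_x (X(x))`. -/
noncomputable def fieldDeriv {n : ℕ}
    (X : EuclideanSpace ℝ (Fin n) → EuclideanSpace ℝ (Fin n))
    (f : EuclideanSpace ℝ (Fin n) → ℝ) : EuclideanSpace ℝ (Fin n) → ℝ :=
  fun x => fderiv ℝ f x (X x)

/-- The coordinate frame `∂/∂x¹, …, ∂/∂xⁿ`. -/
noncomputable def coordFrame (n : ℕ) :
    Fin n → EuclideanSpace ℝ (Fin n) → EuclideanSpace ℝ (Fin n) :=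
  fun i _ => EuclideanSpace.single i (1 : ℝ)

/-- `e` is a `C^∞` moving frame on `Ω`: smooth vector fields, independent at each point. -/
def IsSmoothFrame {n : ℕ} (Ω : Set (EuclideanSpace ℝ (Fin n)))
    (e : Fin n → EuclideanSpace ℝ (Fin n) → EuclideanSpace ℝ (Fin n)) : Prop :=
  (∀ i, ContDiffOn ℝ ∞ (e i) Ω) ∧ ∀ x ∈ Ω, LinearIndependent ℝ (fun i => e i x)

/-- The vector `(e₁φ(x), …, eₙφ(x))`; for the coordinate frame this is `Dφ(x)`. -/
noncomputable def frameGradient {n : ℕ}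
    (e : Fin n → EuclideanSpace ℝ (Fin n) → EuclideanSpace ℝ (Fin n))
    (φ : EuclideanSpace ℝ (Fin n) → ℝ) (x : EuclideanSpace ℝ (Fin n)) : Fin n → ℝ :=
  fun i => fieldDeriv (e i) φ x

/-- The coefficient matrix `ã^{ij}(x) = a^{ij}(x, e₁φ(x), …, eₙφ(x))`. -/
noncomputable def frozenCoeff {n : ℕ}
    (e : Fin n → EuclideanSpace ℝ (Fin n) → EuclideanSpace ℝ (Fin n))
    (a : EuclideanSpace ℝ (Fin n) → (Fin n → ℝ) → Matrix (Fin n) (Fin n) ℝ)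
    (φ : EuclideanSpace ℝ (Fin n) → ℝ) (x : EuclideanSpace ℝ (Fin n)) :
    Matrix (Fin n) (Fin n) ℝ :=
  a x (frameGradient e φ x)

/-- The operator `A^{ij}(x) eᵢ eⱼ f` for a matrix-valued function `A`. -/
noncomputable def secondOrderPart {n : ℕ}
    (e : Fin n → EuclideanSpace ℝ (Fin n) → EuclideanSpace ℝ (Fin n))
    (A : EuclideanSpace ℝ (Fin n) → Matrix (Fin n) (Fin n) ℝ)
    (f : EuclideanSpace ℝ (Fin n) → ℝ) (x : EuclideanSpace ℝ (Fin n)) : ℝ :=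
  ∑ i, ∑ j, A x i j * fieldDeriv (e i) (fieldDeriv (e j) f) x

/-- The quasilinear operator
`a^{ij}(x, e₁φ, …, eₙφ) eᵢ eⱼ φ + b(x, φ, e₁φ, …, eₙφ)`. -/
noncomputable def frameQuasilinearOp {n : ℕ}
    (e : Fin n → EuclideanSpace ℝ (Fin n) → EuclideanSpace ℝ (Fin n))
    (a : EuclideanSpace ℝ (Fin n) → (Fin n → ℝ) → Matrix (Fin n) (Fin n) ℝ)
    (b : EuclideanSpace ℝ (Fin n) → ℝ → (Fin n → ℝ) → ℝ)
    (φ : EuclideanSpace ℝ (Fin n) → ℝ) (x : EuclideanSpace ℝ (Fin n)) : ℝ :=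
  secondOrderPart e (frozenCoeff e a φ) φ x + b x (φ x) (frameGradient e φ x)

/-- The quasilinear operator `Qφ = a^{ij}(x, Dφ) D_{ij} φ + b(x, φ, Dφ)`. -/
noncomputable def quasilinearOp {n : ℕ}
    (a : EuclideanSpace ℝ (Fin n) → (Fin n → ℝ) → Matrix (Fin n) (Fin n) ℝ)
    (b : EuclideanSpace ℝ (Fin n) → ℝ → (Fin n → ℝ) → ℝ)
    (φ : EuclideanSpace ℝ (Fin n) → ℝ) (x : EuclideanSpace ℝ (Fin n)) : ℝ :=
  frameQuasilinearOp (coordFrame n) a b φ x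

/-- `X₁, …, X_r` and `Y` are `C^∞` vector fields on `Ω` with
`A^{ij}(x) eᵢ eⱼ = ∑ₖ Xₖ² + Y` as differential operators on `Ω`. -/
def IsSumOfSquares {n r : ℕ} (Ω : Set (EuclideanSpace ℝ (Fin n)))
    (e : Fin n → EuclideanSpace ℝ (Fin n) → EuclideanSpace ℝ (Fin n))
    (A : EuclideanSpace ℝ (Fin n) → Matrix (Fin n) (Fin n) ℝ)
    (X : Fin r → EuclideanSpace ℝ (Fin n) → EuclideanSpace ℝ (Fin n))
    (Y : EuclideanSpace ℝ (Fin n) → EuclideanSpace ℝ (Fin n)) : Prop :=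
  (∀ k, ContDiffOn ℝ ∞ (X k) Ω) ∧ ContDiffOn ℝ ∞ Y Ω ∧
    ∀ f : EuclideanSpace ℝ (Fin n) → ℝ, ContDiffOn ℝ ∞ f Ω → ∀ x ∈ Ω,
      secondOrderPart e A f x
        = ∑ k, fieldDeriv (X k) (fieldDeriv (X k) f) x + fieldDeriv Y f x

/-- `£(X₁, …, X_r)`: the smallest `C^∞(Ω)`-module of vector fields on `Ω` that contains
`X₁, …, X_r` and is closed under the Lie bracket. A vector field on `Ω` is represented by
any function on the whole space that agrees with it on `Ω` (clause `congr`). -/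
inductive LieSpan {n r : ℕ} (Ω : Set (EuclideanSpace ℝ (Fin n)))
    (X : Fin r → EuclideanSpace ℝ (Fin n) → EuclideanSpace ℝ (Fin n)) :
    (EuclideanSpace ℝ (Fin n) → EuclideanSpace ℝ (Fin n)) → Prop
  | gen (k : Fin r) : LieSpan Ω X (X k)
  | zero : LieSpan Ω X (fun _ => 0)
  | add {V W : EuclideanSpace ℝ (Fin n) → EuclideanSpace ℝ (Fin n)} :
      LieSpan Ω X V → LieSpan Ω X W →
      LieSpan Ω X (fun x => V x + W x)
  | smul {g : EuclideanSpace ℝ (Fin n) → ℝ}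
      {V : EuclideanSpace ℝ (Fin n) → EuclideanSpace ℝ (Fin n)} :
      ContDiffOn ℝ ∞ g Ω → LieSpan Ω X V →
      LieSpan Ω X (fun x => g x • V x)
  | bracket {V W : EuclideanSpace ℝ (Fin n) → EuclideanSpace ℝ (Fin n)} :
      LieSpan Ω X V → LieSpan Ω X W →
      LieSpan Ω X (VectorField.lieBracket ℝ V W)
  | congr {V W : EuclideanSpace ℝ (Fin n) → EuclideanSpace ℝ (Fin n)} :
      Set.EqOn V W Ω → LieSpan Ω X V → LieSpan Ω X W

/-- Let `Γ` be an integral curve in `Ω`, defined on an arbitrary interval `I`, of a vector field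
`Z ∈ £(X₁, …, X_r)`. If `w` achieves a nonnegative maximum over `Ω` at a point of `Γ`, then
that maximum is attained at all points of `Γ`. -/
def MaxPropagates {n r : ℕ} (Ω : Set (EuclideanSpace ℝ (Fin n)))
    (X : Fin r → EuclideanSpace ℝ (Fin n) → EuclideanSpace ℝ (Fin n))
    (w : EuclideanSpace ℝ (Fin n) → ℝ) : Prop :=
  ∀ Z : EuclideanSpace ℝ (Fin n) → EuclideanSpace ℝ (Fin n), LieSpan Ω X Z →
    ∀ (I : Set ℝ) (Γ : ℝ → EuclideanSpace ℝ (Fin n)),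
      I.OrdConnected → Set.MapsTo Γ I Ω → IsIntegralCurveOn Γ (fun _ => Z) I →
      (∃ t₀ ∈ I, IsMaxOn w Ω (Γ t₀) ∧ 0 ≤ w (Γ t₀)) →
      ∀ t ∈ I, IsMaxOn w Ω (Γ t)

/-! Set `w = φ - ψ`. Since `b` is nonincreasing in `z`, the inequality `Qφ ≥ Qψ` linearizes near a
nonnegative maximum of `w` to `∑ Xₖ² w + Y w ≥ -K (w⁻ + |∇w|)`.

Let `F` be the set where `w` attains its nonnegative maximum. E. Hopf's barrier argument shows that
each `Xₖ` is tangent to `F` in Bony's sense: at a point of `F` nearest to an exterior point `y`, it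
is orthogonal to the direction of `y`. Fields tangent to `F` form a module, and their flows preserve
`F`; running the flows of two such fields around a commutator shows that the bracket is tangent
too. So every field of the Lie span is tangent, and `F` is invariant along its integral curves.

If the coefficient matrix `A ≥ 0` has constant rank, then its kernel projection `P` is smooth, being
a fixed rational expression in `A`, and `A + P` is positive definite. A smooth Cholesky
factorization `A + P = L Lᵀ` gives `A = B Bᵀ` with `B = (1 - P) L`, and the columns of `B` are the
coefficients of the fields `Xₖ`. -/

section Tangency

open Set Filter Topology Metric

variable {E : Type*} [NormedAddCommGroup E] [InnerProductSpace ℝ E]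
  {F Ω : Set E} {V : E → E} {x₀ : E}

/-- `V` is tangent to `F` in Bony's sense: at every point `x ∈ F` it is orthogonal to each exterior
normal `y - x`, that is, whenever `x` is a point of `F` nearest to `y`. -/
def IsTangentTo (V : E → E) (F : Set E) : Prop :=
  ∀ x ∈ F, ∀ y, dist y x = infDist y F → inner ℝ (V x) (y - x) = 0

lemma IsTangentTo.neg (h : IsTangentTo V F) : IsTangentTo (-V) F := fun x hx y hy => by
  rw [Pi.neg_apply, inner_neg_left, h x hx y hy, neg_zero]

lemma exists_dist_eq_infDist_of_isCompact {M : Type*} [PseudoMetricSpace M] {F : Set M}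
    {x₀ p : M} {ρ : ℝ} (hx₀ : x₀ ∈ F) (hF : IsCompact (F ∩ closedBall x₀ (2 * ρ)))
    (hp : p ∈ ball x₀ ρ) : ∃ y ∈ F ∩ closedBall x₀ (2 * ρ), dist p y = infDist p F := by
  have hp' := mem_ball.mp hp
  have hx₀' : x₀ ∈ F ∩ closedBall x₀ (2 * ρ) :=
    ⟨hx₀, mem_closedBall_self (by linarith [dist_nonneg (x := p) (y := x₀)])⟩
  obtain ⟨y, hy, hpy⟩ := hF.exists_infDist_eq_dist ⟨x₀, hx₀'⟩ p
  refine ⟨y, hy, le_antisymm ((le_infDist ⟨x₀, hx₀⟩).mpr fun z hz => ?_)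
    (infDist_le_dist_of_mem hy.1)⟩
  rw [← hpy]
  by_cases hzρ : z ∈ closedBall x₀ (2 * ρ)
  · exact infDist_le_dist_of_mem ⟨hz, hzρ⟩
  · have := infDist_le_dist_of_mem (x := p) hx₀'
    have : 2 * ρ < dist z x₀ := not_le.mp hzρ
    linarith [dist_triangle_left z x₀ p]

/-- The upper right Dini derivative of `infDist (γ t) F ^ 2` is at most
`2 * K * infDist (γ t) F ^ 2`, because the square of the distance to the fixed nearest point `y`
touches it from above. -/
lemma IsTangentTo.eventually_slope_infDist_sq_lt (hV : IsTangentTo V F) {γ : ℝ → E} {t K r : ℝ}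
    {y : E} (hy : y ∈ F) (hyt : dist (γ t) y = infDist (γ t) F)
    (hK : dist (V (γ t)) (V y) ≤ K * dist (γ t) y)
    (hγ : HasDerivWithinAt γ (V (γ t)) (Ici t) t) (hr : 2 * K * infDist (γ t) F ^ 2 < r) :
    ∀ᶠ z in 𝓝[>] t, (z - t)⁻¹ * (infDist (γ z) F ^ 2 - infDist (γ t) F ^ 2) < r := by
  have hderiv : HasDerivWithinAt (fun z => ‖γ z - y‖ ^ 2)
      (2 * inner ℝ (γ t - y) (V (γ t))) (Ici t) t := (hγ.sub_const y).norm_sq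
  have hle : 2 * inner ℝ (γ t - y) (V (γ t)) ≤ 2 * K * infDist (γ t) F ^ 2 := by
    have hsplit : inner ℝ (γ t - y) (V (γ t)) = inner ℝ (γ t - y) (V (γ t) - V y) := by
      rw [inner_sub_right, real_inner_comm (V y), hV y hy _ hyt, sub_zero]
    have hcs := real_inner_le_norm (γ t - y) (V (γ t) - V y)
    rw [← hyt, hsplit]
    rw [dist_eq_norm, dist_eq_norm] at hK
    rw [dist_eq_norm]
    nlinarith [norm_nonneg (γ t - y)]
  have hslope := (hasDerivWithinAt_iff_tendsto_slope' self_notMem_Ioi).mp hderiv.Ioi_of_Ici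
  filter_upwards [hslope.eventually_lt_const (hle.trans_lt hr), self_mem_nhdsWithin] with z hz hzt
  refine lt_of_le_of_lt ?_ hz
  rw [slope_def_module, smul_eq_mul, ← dist_eq_norm, ← dist_eq_norm, ← hyt]
  have : 0 ≤ (z - t)⁻¹ := inv_nonneg.mpr (sub_nonneg.mpr (le_of_lt hzt))
  gcongr
  exacts [infDist_nonneg, infDist_le_dist_of_mem hy]

lemma IsTangentTo.mem_of_hasDerivWithinAt_of_le (hV : IsTangentTo V F) (hx₀ : x₀ ∈ F) {ρ : ℝ}
    (hF : IsCompact (F ∩ closedBall x₀ (2 * ρ))) {K : NNReal}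
    (hK : LipschitzOnWith K V (closedBall x₀ (2 * ρ))) {γ : ℝ → E} {a b : ℝ} (hab : a ≤ b)
    (hγ : ∀ t ∈ Icc a b, HasDerivWithinAt γ (V (γ t)) (Icc a b) t)
    (hball : MapsTo γ (Icc a b) (ball x₀ ρ)) (ha : γ a ∈ F) : γ b ∈ F := by
  have hnear : ∀ t ∈ Icc a b, ∃ y ∈ F ∩ closedBall x₀ (2 * ρ),
      dist (γ t) y = infDist (γ t) F := fun t ht =>
    exists_dist_eq_infDist_of_isCompact hx₀ hF (hball ht)
  have hsub : ball x₀ ρ ⊆ closedBall x₀ (2 * ρ) := fun z hz => by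
    have := mem_ball.mp hz
    exact mem_closedBall.mpr (by linarith [dist_nonneg (x := z) (y := x₀)])
  have hcont : ContinuousOn γ (Icc a b) := fun t ht => (hγ t ht).continuousWithinAt
  have hgronwall : ∀ t ∈ Icc a b, infDist (γ t) F ^ 2 ≤ gronwallBound 0 (2 * K) 0 (t - a) := by
    refine le_gronwallBound_of_liminf_deriv_right_le
      (f' := fun t => 2 * K * infDist (γ t) F ^ 2)
      (((continuous_infDist_pt F).comp_continuousOn hcont).pow 2) (fun t ht r hr => ?_)
      (by simp [infDist_zero_of_mem ha]) (by simp)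
    obtain ⟨y, hy, hyt⟩ := hnear t (Ico_subset_Icc_self ht)
    exact (hV.eventually_slope_infDist_sq_lt hy.1 hyt
      (hK.dist_le_mul _ (hsub (hball (Ico_subset_Icc_self ht))) _ hy.2)
      ((hγ t (Ico_subset_Icc_self ht)).mono_of_mem_nhdsWithin
        (Icc_mem_nhdsGE_of_mem ht)) hr).frequently
  have hb := right_mem_Icc.mpr hab
  obtain ⟨y, hy, hyb⟩ := hnear b hb
  have hzero : infDist (γ b) F = 0 :=
    pow_eq_zero_iff two_ne_zero |>.mp <|
      le_antisymm ((hgronwall b hb).trans_eq (gronwallBound_ε0_δ0 _ _)) (sq_nonneg _)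
  exact dist_eq_zero.mp (hyb.trans hzero) ▸ hy.1

lemma IsTangentTo.mem_of_isIntegralCurveOn_of_mapsTo_ball (hV : IsTangentTo V F) (hx₀ : x₀ ∈ F)
    {ρ : ℝ} (hF : IsCompact (F ∩ closedBall x₀ (2 * ρ))) {K : NNReal}
    (hK : LipschitzOnWith K V (closedBall x₀ (2 * ρ))) {γ : ℝ → E} {I : Set ℝ}
    (hI : I.OrdConnected) (hγ : IsIntegralCurveOn γ (fun _ => V) I)
    (hball : MapsTo γ I (ball x₀ ρ)) {s t : ℝ} (hs : s ∈ I) (ht : t ∈ I) (hsF : γ s ∈ F) :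
    γ t ∈ F := by
  rcases le_total s t with hst | hts
  · exact hV.mem_of_hasDerivWithinAt_of_le hx₀ hF hK hst
      (fun u hu => (hγ u (hI.out hs ht hu)).mono (hI.out hs ht))
      (hball.mono_left (hI.out hs ht)) hsF
  · have hneg : MapsTo Neg.neg (Icc (-s) (-t)) (Icc t s) := fun u hu =>
      ⟨by linarith [hu.2], by linarith [hu.1]⟩
    have hderiv : ∀ u ∈ Icc (-s) (-t),
        HasDerivWithinAt (γ ∘ Neg.neg) ((-V) ((γ ∘ Neg.neg) u)) (Icc (-s) (-t)) u := fun u hu => by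
      simpa using ((hγ (-u) (hI.out ht hs (hneg hu))).mono (hI.out ht hs)).scomp u
        (hasDerivWithinAt_neg u _) hneg
    simpa using hV.neg.mem_of_hasDerivWithinAt_of_le hx₀ hF (K := K)
      (LipschitzOnWith.of_dist_le_mul fun x hx y hy => by
        simpa only [Pi.neg_apply, dist_neg_neg] using hK.dist_le_mul x hx y hy)
      (neg_le_neg hts) hderiv ((hball.mono_left (hI.out ht hs)).comp hneg) (by simpa using hsF)

variable [ProperSpace E]

lemma IsTangentTo.exists_ball_forall_mem (hV : IsTangentTo V F) (hF : IsLocallyClosed F)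
    (hx₀ : x₀ ∈ F) (hV₁ : ContDiffAt ℝ 1 V x₀) :
    ∃ ρ > 0, ∀ (γ : ℝ → E) (I : Set ℝ), I.OrdConnected → IsIntegralCurveOn γ (fun _ => V) I →
      MapsTo γ I (ball x₀ ρ) → ∀ s ∈ I, ∀ t ∈ I, γ s ∈ F → γ t ∈ F := by
  obtain ⟨K, T, hT, hK⟩ := hV₁.exists_lipschitzOnWith
  obtain ⟨U, Z, hU, hZ, rfl⟩ := hF
  obtain ⟨R, hR, hRUT⟩ := nhds_basis_closedBall.mem_iff.mp
    (inter_mem (hU.mem_nhds hx₀.1) hT)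
  have hRR : 2 * (R / 2) = R := by ring
  have hcompact : IsCompact (U ∩ Z ∩ closedBall x₀ (2 * (R / 2))) := by
    rw [hRR, inter_right_comm, inter_eq_right.mpr fun x hx => (hRUT hx).1]
    exact (isCompact_closedBall x₀ R).inter_right hZ
  refine ⟨R / 2, by positivity, fun γ I hI hγ hball s hs t ht hsF => ?_⟩
  exact hV.mem_of_isIntegralCurveOn_of_mapsTo_ball hx₀ hcompact
    (hK.mono fun x hx => (hRUT (hRR ▸ hx)).2) hI hγ hball hs ht hsF

theorem IsTangentTo.mem_of_isIntegralCurveOn (hV : IsTangentTo V F) (hΩ : IsOpen Ω)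
    (hF : Ω ∩ closure F = F) (hV₁ : ∀ x ∈ F, ContDiffAt ℝ 1 V x) {I : Set ℝ} {γ : ℝ → E}
    (hI : I.OrdConnected) (hγΩ : MapsTo γ I Ω) (hγ : IsIntegralCurveOn γ (fun _ => V) I)
    {t₀ : ℝ} (ht₀ : t₀ ∈ I) (h₀ : γ t₀ ∈ F) : ∀ t ∈ I, γ t ∈ F := by
  have hloc : IsLocallyClosed F := hF ▸ hΩ.isLocallyClosed.inter isClosed_closure.isLocallyClosed
  have hcont : ContinuousOn γ I := fun t ht => (hγ t ht).continuousWithinAt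
  have hconst : ∀ s ∈ I, ∀ᶠ t in 𝓝[I] s, (γ s ∈ F ↔ γ t ∈ F) := by
    intro s hs
    by_cases hsF : γ s ∈ F
    · obtain ⟨ρ, hρ, hinv⟩ := hV.exists_ball_forall_mem hloc hsF (hV₁ _ hsF)
      obtain ⟨δ, hδ, hδρ⟩ := Metric.mem_nhdsWithin_iff.mp (hcont s hs (ball_mem_nhds _ hρ))
      filter_upwards [inter_mem_nhdsWithin I (ball_mem_nhds s hδ)] with t ht
      refine iff_of_true hsF (hinv γ (I ∩ ball s δ)
        (hI.inter (Real.ball_eq_Ioo s δ ▸ ordConnected_Ioo)) (hγ.mono inter_subset_left)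
        (fun u hu => hδρ hu.symm) s ⟨hs, mem_ball_self hδ⟩ t ht hsF)
    · have hs' : γ s ∈ (closure F)ᶜ := fun h => hsF (hF ▸ ⟨hγΩ hs, h⟩)
      filter_upwards [hcont s hs (isClosed_closure.isOpen_compl.mem_nhds hs')] with t ht
      exact iff_of_false hsF fun htF => ht (subset_closure htF)
  exact fun t ht => (hI.isPreconnected.induction₂ (fun s u => (γ s ∈ F ↔ γ u ∈ F)) hconst
    (fun _ _ _ _ _ _ h h' => h.trans h') (fun _ _ _ _ h => h.symm) ht₀ ht).mp h₀

end Tangency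

section Flows

open Set Filter Topology Metric Asymptotics

lemma isBigO_sub_of_hasDerivAt {M G : Type*} [PseudoMetricSpace M] [NormedAddCommGroup G]
    [NormedSpace ℝ G] {u u' : M × ℝ → G} {x₀ : M} {k : ℕ}
    (hu : ∀ᶠ q in 𝓝 (x₀, (0 : ℝ)), HasDerivAt (fun t => u (q.1, t)) (u' q) q.2)
    (hu' : u' =O[𝓝 (x₀, 0)] fun q => q.2 ^ k) :
    (fun q => u q - u (q.1, 0)) =O[𝓝 (x₀, 0)] fun q => q.2 ^ (k + 1) := by
  obtain ⟨C, hC₀, hC⟩ := hu'.exists_nonneg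
  obtain ⟨ε, hε, hball⟩ := Metric.eventually_nhds_iff_ball.mp (hu.and hC.bound)
  refine IsBigO.of_bound C ?_
  filter_upwards [ball_mem_nhds (x₀, (0 : ℝ)) hε] with q hq
  have hle : ∀ t ∈ uIcc 0 q.2, |t| ≤ |q.2| := fun t ht => by
    simpa using abs_sub_left_of_mem_uIcc ht
  have hmem : ∀ t ∈ uIcc 0 q.2, (q.1, t) ∈ ball (x₀, (0 : ℝ)) ε := fun t ht => by
    rw [← ball_prod_same, mem_prod, mem_ball_zero_iff] at hq ⊢
    exact ⟨hq.1, (hle t ht).trans_lt hq.2⟩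
  have := (convex_uIcc (0 : ℝ) q.2).norm_image_sub_le_of_norm_hasDerivWithin_le
    (f := fun t => u (q.1, t)) (f' := fun t => u' (q.1, t)) (C := C * |q.2| ^ k)
    (fun t ht => (hball _ (hmem t ht)).1.hasDerivWithinAt)
    (fun t ht => (hball _ (hmem t ht)).2.trans <| by
      rw [norm_pow, Real.norm_eq_abs]
      exact mul_le_mul_of_nonneg_left (pow_le_pow_left₀ (abs_nonneg t) (hle t ht) k) hC₀)
    left_mem_uIcc right_mem_uIcc
  simpa [pow_succ, mul_assoc] using this

variable {E : Type*} [NormedAddCommGroup E] [NormedSpace ℝ E]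
  {G : Type*} [NormedAddCommGroup G] [NormedSpace ℝ G]
  {V W : E → E} {g : E → G} {x₀ : E} {Φ θ₁ θ₂ : E × ℝ → E}

/-- The Lie derivative `V g` of a vector-valued function `g` along the vector field `V`. -/
noncomputable def lieDeriv (V : E → E) (g : E → G) (x : E) : G :=
  fderiv ℝ g x (V x)

lemma contDiffAt_lieDeriv (hV : ContDiffAt ℝ ∞ V x₀) (hg : ContDiffAt ℝ ∞ g x₀) :
    ContDiffAt ℝ ∞ (lieDeriv V g) x₀ :=
  (hg.fderiv_right (by simp)).clm_apply hV

lemma lieDeriv_neg_left (V : E → E) (g : E → G) : lieDeriv (-V) g = -lieDeriv V g := by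
  ext x
  simp [lieDeriv]

/-- `Φ (x, t)` is, for `(x, t)` near `(x₀, 0)`, the position at time `t` of the integral curve of
`V` started at `x`. -/
structure IsLocalFlowAt (V : E → E) (Φ : E × ℝ → E) (x₀ : E) : Prop where
  hasDerivAt : ∀ᶠ q in 𝓝 (x₀, (0 : ℝ)), HasDerivAt (fun t => Φ (q.1, t)) (V (Φ q)) q.2
  map_zero : ∀ᶠ x in 𝓝 x₀, Φ (x, 0) = x
  tendsto : Tendsto Φ (𝓝 (x₀, 0)) (𝓝 x₀)

lemma exists_isLocalFlowAt [CompleteSpace E] (hV : ContDiffAt ℝ 1 V x₀) :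
    ∃ Φ, IsLocalFlowAt V Φ x₀ := by
  obtain ⟨ε, hε, a, r, L, K, hr, hpl⟩ := IsPicardLindelof.of_contDiffAt_one hV
  obtain ⟨Φ, hΦ, hΦc⟩ := (hpl 0).exists_forall_mem_closedBall_eq_hasDerivWithinAt_continuousOn
  simp only [zero_sub, zero_add] at hΦ hΦc
  have hball : closedBall x₀ r ∈ 𝓝 x₀ := closedBall_mem_nhds x₀ hr
  have hIoo : Ioo (-ε) ε ∈ 𝓝 (0 : ℝ) := Ioo_mem_nhds (neg_lt_zero.mpr hε) hε
  refine ⟨Φ, ?_, ?_, ?_⟩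
  · filter_upwards [prod_mem_nhds hball hIoo] with q hq
    exact ((hΦ q.1 hq.1).2 q.2 (Ioo_subset_Icc_self hq.2)).hasDerivAt
      (Icc_mem_nhds hq.2.1 hq.2.2)
  · filter_upwards [hball] with x hx using (hΦ x hx).1
  · have hcont : ContinuousAt Φ (x₀, 0) := hΦc.continuousAt
      (prod_mem_nhds hball (mem_of_superset hIoo Ioo_subset_Icc_self))
    simpa only [ContinuousAt, (hΦ x₀ (mem_of_mem_nhds hball)).1] using hcont

lemma IsLocalFlowAt.hasDerivAt_comp (hΦ : IsLocalFlowAt V Φ x₀) (hg : ContDiffAt ℝ 1 g x₀) :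
    ∀ᶠ q in 𝓝 (x₀, (0 : ℝ)), HasDerivAt (fun t => g (Φ (q.1, t))) (lieDeriv V g (Φ q)) q.2 := by
  filter_upwards [hΦ.hasDerivAt, hΦ.tendsto.eventually (hg.eventually (by simp))] with q hq hgq
  exact (hgq.differentiableAt one_ne_zero).hasFDerivAt.comp_hasDerivAt q.2 hq

lemma IsLocalFlowAt.taylor (hΦ : IsLocalFlowAt V Φ x₀) (hV : ContDiffAt ℝ ∞ V x₀) (n : ℕ) :
    ∀ {g : E → G}, ContDiffAt ℝ ∞ g x₀ →
      (fun q : E × ℝ => g (Φ q) -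
        ∑ k ∈ Finset.range n, (q.2 ^ k / k.factorial) • (lieDeriv V)^[k] g q.1)
        =O[𝓝 (x₀, 0)] fun q => q.2 ^ n := by
  induction n with
  | zero =>
    intro g hg
    simpa using (hg.continuousAt.tendsto.comp hΦ.tendsto).isBigO_one ℝ
  | succ n ih =>
    intro g hg
    have hmono (k : ℕ) (t : ℝ) : HasDerivAt (fun t : ℝ => t ^ (k + 1) / (k + 1).factorial)
        (t ^ k / k.factorial) t := by
      refine ((hasDerivAt_pow (k + 1) t).div_const ((k + 1).factorial : ℝ)).congr_deriv ?_
      rw [Nat.factorial_succ, Nat.cast_mul, Nat.add_sub_cancel]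
      exact mul_div_mul_left _ _ (by positivity)
    have hderiv := (hΦ.hasDerivAt_comp (hg.of_le (by norm_cast))).mono fun q hq =>
      (hq.sub_const (g q.1)).sub <| HasDerivAt.fun_sum fun k (_ : k ∈ Finset.range n) =>
        (hmono k q.2).smul_const ((lieDeriv V)^[k] (lieDeriv V g) q.1)
    refine (isBigO_sub_of_hasDerivAt (u := fun q => g (Φ q) - g q.1 - ∑ k ∈ Finset.range n,
      (q.2 ^ (k + 1) / (k + 1).factorial) • (lieDeriv V)^[k] (lieDeriv V g) q.1)
      hderiv (ih (contDiffAt_lieDeriv hV hg))).congr' ?_ .rfl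
    filter_upwards [continuousAt_fst.eventually hΦ.map_zero] with q hq
    simp [Finset.sum_range_succ', hq]
    abel

lemma isBigO_pow_smul {M G : Type*} [TopologicalSpace M] [NormedAddCommGroup G]
    [NormedSpace ℝ G] {x₀ : M} {h : M × ℝ → G} (hh : ContinuousAt h (x₀, 0)) (k : ℕ) :
    (fun q => q.2 ^ k • h q) =O[𝓝 (x₀, 0)] fun q => q.2 ^ k := by
  simpa using (isBigO_refl (fun q : M × ℝ => q.2 ^ k) _).smul (hh.isBigO_one ℝ)

/-- `g (θ (x, t)) = g x + t D g x + t² P g x + O(t³)` near `(x₀, 0)` for all smooth `G`-valued `g`.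
The operators `D` and `P` compose like the Taylor coefficients of the exponential series. -/
structure HasSecondOrderExpansionAt (θ : E × ℝ → E) (D P : (E → G) → E → G) (x₀ : E) : Prop where
  tendsto : Tendsto θ (𝓝 (x₀, 0)) (𝓝 x₀)
  contDiffAt_first : ∀ g, ContDiffAt ℝ ∞ g x₀ → ContDiffAt ℝ ∞ (D g) x₀
  contDiffAt_second : ∀ g, ContDiffAt ℝ ∞ g x₀ → ContDiffAt ℝ ∞ (P g) x₀
  isBigO : ∀ g, ContDiffAt ℝ ∞ g x₀ →
    (fun q => g (θ q) - (g q.1 + q.2 • D g q.1 + q.2 ^ 2 • P g q.1))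
      =O[𝓝 (x₀, 0)] fun q => q.2 ^ 3

lemma IsLocalFlowAt.hasSecondOrderExpansionAt (hΦ : IsLocalFlowAt V Φ x₀)
    (hV : ContDiffAt ℝ ∞ V x₀) :
    HasSecondOrderExpansionAt Φ (lieDeriv V)
      (fun g : E → G => (2⁻¹ : ℝ) • lieDeriv V (lieDeriv V g)) x₀ where
  tendsto := hΦ.tendsto
  contDiffAt_first g hg := contDiffAt_lieDeriv hV hg
  contDiffAt_second g hg :=
    contDiffAt_const.smul (contDiffAt_lieDeriv hV (contDiffAt_lieDeriv hV hg))
  isBigO g hg := (hΦ.taylor hV 3 hg).congr_left fun q => by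
    simp [Finset.sum_range_succ, smul_smul, div_eq_mul_inv]

namespace HasSecondOrderExpansionAt

variable {D P D₁ P₁ D₂ P₂ : (E → G) → E → G} {θ : E × ℝ → E}

lemma tendsto_prodMk (h : HasSecondOrderExpansionAt θ D P x₀) :
    Tendsto (fun q => (θ q, q.2)) (𝓝 (x₀, 0)) (𝓝 (x₀, 0)) :=
  h.tendsto.prodMk_nhds continuousAt_snd

lemma isBigO_firstOrder (h : HasSecondOrderExpansionAt θ D P x₀) (hg : ContDiffAt ℝ ∞ g x₀) :
    (fun q => g (θ q) - (g q.1 + q.2 • D g q.1)) =O[𝓝 (x₀, 0)] fun q => q.2 ^ 2 := by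
  have hle : (fun q : E × ℝ => q.2 ^ 3) =O[𝓝 (x₀, 0)] fun q => q.2 ^ 2 :=
    (isBigO_pow_smul continuousAt_snd 2).congr_left fun q => (pow_succ q.2 2).symm
  have hP := (h.contDiffAt_second g hg).continuousAt.comp' (continuousAt_fst (p := (x₀, (0 : ℝ))))
  refine (((h.isBigO g hg).trans hle).add (isBigO_pow_smul hP 2)).congr_left fun q => ?_
  abel

lemma isBigO_zerothOrder (h : HasSecondOrderExpansionAt θ D P x₀) (hg : ContDiffAt ℝ ∞ g x₀) :
    (fun q => g (θ q) - g q.1) =O[𝓝 (x₀, 0)] fun q => q.2 ^ 1 := by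
  have hle : (fun q : E × ℝ => q.2 ^ 2) =O[𝓝 (x₀, 0)] fun q => q.2 ^ 1 :=
    (isBigO_pow_smul continuousAt_snd 1).congr_left fun q => (pow_succ q.2 1).symm
  have hD := (h.contDiffAt_first g hg).continuousAt.comp' (continuousAt_fst (p := (x₀, (0 : ℝ))))
  refine (((h.isBigO_firstOrder hg).trans hle).add (isBigO_pow_smul hD 1)).congr_left fun q => ?_
  rw [pow_one]
  abel

lemma comp (h₁ : HasSecondOrderExpansionAt θ₁ D₁ P₁ x₀)
    (h₂ : HasSecondOrderExpansionAt θ₂ D₂ P₂ x₀) :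
    HasSecondOrderExpansionAt (fun q => θ₂ (θ₁ q, q.2)) (fun g => D₁ g + D₂ g)
      (fun g => P₁ g + D₁ (D₂ g) + P₂ g) x₀ where
  tendsto := h₂.tendsto.comp h₁.tendsto_prodMk
  contDiffAt_first g hg := (h₁.contDiffAt_first g hg).add (h₂.contDiffAt_first g hg)
  contDiffAt_second g hg := ((h₁.contDiffAt_second g hg).add
    (h₁.contDiffAt_first _ (h₂.contDiffAt_first g hg))).add (h₂.contDiffAt_second g hg)
  isBigO g hg := by
    have hD₂ := (isBigO_refl (fun q : E × ℝ => q.2) _).smul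
      (h₁.isBigO_firstOrder (h₂.contDiffAt_first g hg))
    have hP₂ := (isBigO_refl (fun q : E × ℝ => q.2 ^ 2) _).smul
      (h₁.isBigO_zerothOrder (h₂.contDiffAt_second g hg))
    have hsum := (((h₂.isBigO g hg).comp_tendsto h₁.tendsto_prodMk).add (h₁.isBigO g hg)).add
      ((hD₂.congr_right fun q => (pow_succ' q.2 2).symm).add
        (hP₂.congr_right fun q => (pow_add q.2 2 1).symm))
    refine hsum.congr_left fun q => ?_
    simp only [Function.comp_apply, Pi.add_apply]
    module

end HasSecondOrderExpansionAt

/-- The map `q ↦ θ₄ (θ₃ (θ₂ (θ₁ q, t), t), t)` below has vanishing first-order part, and its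
second-order part is `(V² + 2 V W + W²) - (V + W)² = V W - W V`. -/
lemma isBigO_commutator_sub_lieBracket {θ₁ θ₂ θ₃ θ₄ : E × ℝ → E} (hV : ContDiffAt ℝ ∞ V x₀)
    (hW : ContDiffAt ℝ ∞ W x₀) (h₁ : IsLocalFlowAt V θ₁ x₀) (h₂ : IsLocalFlowAt W θ₂ x₀)
    (h₃ : IsLocalFlowAt (-V) θ₃ x₀) (h₄ : IsLocalFlowAt (-W) θ₄ x₀) :
    (fun t => θ₄ (θ₃ (θ₂ (θ₁ (x₀, t), t), t), t) - x₀ - t ^ 2 • VectorField.lieBracket ℝ V W x₀)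
      =O[𝓝 0] fun t : ℝ => t ^ 3 := by
  have hexp := ((h₁.hasSecondOrderExpansionAt (G := E) hV).comp
    (h₂.hasSecondOrderExpansionAt hW)).comp
      ((h₃.hasSecondOrderExpansionAt hV.neg).comp (h₄.hasSecondOrderExpansionAt hW.neg))
  have hid (U : E → E) : lieDeriv U id = U := by
    ext x
    simp [lieDeriv]
  have hderiv : fderiv ℝ (-V + -W) x₀ = -fderiv ℝ V x₀ + -fderiv ℝ W x₀ :=
    ((hV.differentiableAt (by simp)).hasFDerivAt.neg.add
      (hW.differentiableAt (by simp)).hasFDerivAt.neg).fderiv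
  have hslice : Tendsto (fun t : ℝ => (x₀, t)) (𝓝 0) (𝓝 (x₀, 0)) :=
    (continuous_const.prodMk continuous_id).tendsto' 0 _ rfl
  refine ((hexp.isBigO id contDiffAt_id).comp_tendsto hslice).congr_left fun t => ?_
  simp only [Function.comp_apply, id_eq, lieDeriv_neg_left, hid, Pi.add_apply, Pi.neg_apply,
    Pi.smul_apply]
  simp only [lieDeriv, VectorField.lieBracket, hderiv, fderiv_neg, add_apply, neg_apply]
  module

end Flows

section Brackets

open Set Filter Topology Metric Asymptotics

lemma inner_nonpos_of_norm_le_norm_sub {E : Type*} [NormedAddCommGroup E] [InnerProductSpace ℝ E]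
    {B v : E} {δ : ℝ → E} (hδ : (fun t => δ t - t ^ 2 • B) =O[𝓝 0] fun t : ℝ => t ^ 3)
    (hle : ∀ᶠ t in 𝓝 0, ‖v‖ ≤ ‖v - δ t‖) : inner ℝ v B ≤ 0 := by
  have hlim : Tendsto (fun t : ℝ => (t ^ 2)⁻¹ • δ t) (𝓝[≠] 0) (𝓝 B) := by
    rw [← tendsto_sub_nhds_zero_iff]
    have ho : (fun t : ℝ => t ^ 3) =o[𝓝[≠] 0] fun t : ℝ => t ^ 2 :=
      (isLittleO_pow_pow (by norm_num)).mono nhdsWithin_le_nhds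
    refine ((hδ.mono nhdsWithin_le_nhds).trans_isLittleO ho).tendsto_inv_smul_nhds_zero.congr' ?_
    filter_upwards [self_mem_nhdsWithin] with t ht
    rw [smul_sub, inv_smul_smul₀ (pow_ne_zero 2 ht)]
  have hsq : Tendsto (fun t : ℝ => t ^ 2 * ‖(t ^ 2)⁻¹ • δ t‖ ^ 2) (𝓝[≠] 0) (𝓝 0) := by
    have h0 : Tendsto (fun t : ℝ => t ^ 2) (𝓝[≠] 0) (𝓝 0) :=
      ((continuous_pow 2).tendsto' 0 0 (by simp)).mono_left nhdsWithin_le_nhds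
    simpa using h0.mul (hlim.norm.pow 2)
  have hbound := le_of_tendsto_of_tendsto ((tendsto_const_nhds (x := v)).inner hlim |>.const_mul 2)
    hsq ?_
  · linarith
  filter_upwards [nhdsWithin_le_nhds hle, self_mem_nhdsWithin] with t ht ht0
  have hpos : 0 < t ^ 2 := sq_pos_of_ne_zero ht0
  obtain ⟨u, hu⟩ : ∃ u, δ t = t ^ 2 • u := ⟨_, (smul_inv_smul₀ hpos.ne' _).symm⟩
  have hexpand := norm_sub_sq_real v (δ t)
  rw [hu, inner_smul_right, norm_smul, Real.norm_of_nonneg hpos.le] at hexpand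
  rw [hu] at ht ⊢
  rw [inv_smul_smul₀ hpos.ne']
  have hmul : 0 ≤ t ^ 2 * (t ^ 2 * ‖u‖ ^ 2 - 2 * inner ℝ v u) := by
    nlinarith [pow_le_pow_left₀ (norm_nonneg v) ht 2]
  linarith [nonneg_of_mul_nonneg_right hmul hpos]

variable {E : Type*} [NormedAddCommGroup E] [InnerProductSpace ℝ E] [ProperSpace E]
  {F : Set E} {V W : E → E} {x₀ : E}

lemma IsTangentTo.eventually_mem_of_isLocalFlowAt {Φ : E × ℝ → E} (hV : IsTangentTo V F)
    (hF : IsLocallyClosed F) (hx₀ : x₀ ∈ F) (hV₁ : ContDiffAt ℝ 1 V x₀)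
    (hΦ : IsLocalFlowAt V Φ x₀) : ∀ᶠ q in 𝓝 (x₀, (0 : ℝ)), q.1 ∈ F → Φ q ∈ F := by
  obtain ⟨ρ, hρ, hinv⟩ := hV.exists_ball_forall_mem hF hx₀ hV₁
  have hev := (hΦ.hasDerivAt.and (hΦ.tendsto.eventually (ball_mem_nhds x₀ hρ))).and
    (continuousAt_fst.eventually hΦ.map_zero)
  obtain ⟨ε, hε, hball⟩ := Metric.eventually_nhds_iff_ball.mp hev
  filter_upwards [ball_mem_nhds (x₀, (0 : ℝ)) hε] with q hq hqF
  rw [← ball_prod_same] at hball hq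
  have h0 : (0 : ℝ) ∈ ball (0 : ℝ) ε := mem_ball_self hε
  refine hinv (fun t => Φ (q.1, t)) (ball 0 ε) (Real.ball_eq_Ioo 0 ε ▸ ordConnected_Ioo)
    (fun t ht => (hball (q.1, t) ⟨hq.1, ht⟩).1.1.hasDerivWithinAt)
    (fun t ht => (hball (q.1, t) ⟨hq.1, ht⟩).1.2) 0 h0 q.2 hq.2 ?_
  rwa [(hball (q.1, 0) ⟨hq.1, h0⟩).2]

lemma IsTangentTo.inner_lieBracket_nonpos (hV : IsTangentTo V F) (hW : IsTangentTo W F)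
    (hF : IsLocallyClosed F) (hx₀ : x₀ ∈ F) (hVs : ContDiffAt ℝ ∞ V x₀)
    (hWs : ContDiffAt ℝ ∞ W x₀) {y : E} (hy : dist y x₀ = infDist y F) :
    inner ℝ (y - x₀) (VectorField.lieBracket ℝ V W x₀) ≤ 0 := by
  have hflow {U : E → E} (hU : IsTangentTo U F) (hUs : ContDiffAt ℝ ∞ U x₀) :
      ∃ Φ, IsLocalFlowAt U Φ x₀ ∧ ∀ᶠ q in 𝓝 (x₀, (0 : ℝ)), q.1 ∈ F → Φ q ∈ F := by
    have hU₁ : ContDiffAt ℝ 1 U x₀ := hUs.of_le (by norm_cast)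
    obtain ⟨Φ, hΦ⟩ := exists_isLocalFlowAt hU₁
    exact ⟨Φ, hΦ, hU.eventually_mem_of_isLocalFlowAt hF hx₀ hU₁ hΦ⟩
  obtain ⟨θ₁, h₁, hF₁⟩ := hflow hV hVs
  obtain ⟨θ₂, h₂, hF₂⟩ := hflow hW hWs
  obtain ⟨θ₃, h₃, hF₃⟩ := hflow hV.neg hVs.neg
  obtain ⟨θ₄, h₄, hF₄⟩ := hflow hW.neg hWs.neg
  have hp₀ : Tendsto (fun t : ℝ => (x₀, t)) (𝓝 0) (𝓝 (x₀, 0)) :=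
    (continuous_const.prodMk continuous_id).tendsto' 0 _ rfl
  have hp₁ := (h₁.tendsto.comp hp₀).prodMk_nhds (tendsto_id (x := 𝓝 (0 : ℝ)))
  have hp₂ := (h₂.tendsto.comp hp₁).prodMk_nhds (tendsto_id (x := 𝓝 (0 : ℝ)))
  have hp₃ := (h₃.tendsto.comp hp₂).prodMk_nhds (tendsto_id (x := 𝓝 (0 : ℝ)))
  refine inner_nonpos_of_norm_le_norm_sub
    (isBigO_commutator_sub_lieBracket hVs hWs h₁ h₂ h₃ h₄) ?_
  filter_upwards [hp₀.eventually hF₁, hp₁.eventually hF₂, hp₂.eventually hF₃,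
    hp₃.eventually hF₄] with t m₁ m₂ m₃ m₄
  rw [sub_sub_sub_cancel_right, ← dist_eq_norm, ← dist_eq_norm, hy]
  exact infDist_le_dist_of_mem (m₄ (m₃ (m₂ (m₁ hx₀))))

theorem IsTangentTo.lieBracket (hV : IsTangentTo V F) (hW : IsTangentTo W F)
    (hF : IsLocallyClosed F) (hVs : ∀ x ∈ F, ContDiffAt ℝ ∞ V x)
    (hWs : ∀ x ∈ F, ContDiffAt ℝ ∞ W x) : IsTangentTo (VectorField.lieBracket ℝ V W) F := by
  intro x hx y hy
  have hVW := hV.inner_lieBracket_nonpos hW hF hx (hVs x hx) (hWs x hx) hy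
  have hWV := hW.inner_lieBracket_nonpos hV hF hx (hWs x hx) (hVs x hx) hy
  rw [VectorField.lieBracket_swap, inner_neg_right] at hWV
  rw [real_inner_comm]
  linarith

end Brackets

section SecondOrder

open Set Filter Topology

lemma deriv_deriv_nonpos_of_isLocalMax {q : ℝ → ℝ} {t : ℝ} (hmax : IsLocalMax q t)
    (hq : ContinuousAt q t) : deriv (deriv q) t ≤ 0 := by
  by_contra! hpos
  have hmin := isLocalMin_of_deriv_deriv_pos hpos hmax.deriv_eq_zero hq
  have hconst : q =ᶠ[𝓝 t] fun _ => q t := by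
    filter_upwards [hmin, hmax] with s h₁ h₂ using le_antisymm h₂ h₁
  simp [hconst.deriv.deriv_eq] at hpos

lemma deriv_deriv_comp_add_smul {E : Type*} [NormedAddCommGroup E] [NormedSpace ℝ E] {f : E → ℝ}
    {x : E} (hf : ContDiffAt ℝ 2 f x) (u : E) :
    deriv (deriv fun t : ℝ => f (x + t • u)) 0 = fderiv ℝ (fderiv ℝ f) x u u := by
  have hline (t : ℝ) : HasDerivAt (fun t : ℝ => x + t • u) u t := by
    simpa using ((hasDerivAt_id t).smul_const u).const_add x
  have hline₀ : Tendsto (fun t : ℝ => x + t • u) (𝓝 0) (𝓝 x) := by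
    simpa using (hline 0).continuousAt.tendsto
  have hdiff : ∀ᶠ z in 𝓝 x, DifferentiableAt ℝ f z :=
    (hf.eventually (by simp)).mono fun z hz => hz.differentiableAt (by simp)
  have hderiv : deriv (fun t : ℝ => f (x + t • u)) =ᶠ[𝓝 0] fun t => fderiv ℝ f (x + t • u) u := by
    filter_upwards [hline₀.eventually hdiff] with t ht
    exact (ht.hasFDerivAt.comp_hasDerivAt t (hline t)).deriv
  have hdiff₂ : DifferentiableAt ℝ (fderiv ℝ f) x :=
    (hf.fderiv_right (m := 1) (by norm_num)).differentiableAt (by simp)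
  have hderiv₂ : HasDerivAt (fun t : ℝ => fderiv ℝ f (x + t • u)) (fderiv ℝ (fderiv ℝ f) x u) 0 :=
    hdiff₂.hasFDerivAt.comp_hasDerivAt_of_eq (0 : ℝ) (hline 0) (by simp)
  rw [hderiv.deriv_eq]
  simpa using (hderiv₂.clm_apply (hasDerivAt_const 0 u)).deriv

lemma fderiv_fderiv_nonpos_of_isLocalMax {E : Type*} [NormedAddCommGroup E] [NormedSpace ℝ E]
    {f : E → ℝ} {x : E} (hf : ContDiffAt ℝ 2 f x) (hmax : IsLocalMax f x) (u : E) :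
    fderiv ℝ (fderiv ℝ f) x u u ≤ 0 := by
  have hline : ContinuousAt (fun t : ℝ => x + t • u) 0 := by fun_prop
  have hlim : Tendsto (fun t : ℝ => x + t • u) (𝓝 0) (𝓝 x) := by simpa using hline.tendsto
  rw [← deriv_deriv_comp_add_smul hf]
  refine deriv_deriv_nonpos_of_isLocalMax ?_ (hf.continuousAt.comp_of_eq hline (by simp))
  simpa [IsLocalMax, IsMaxFilter] using hlim.eventually hmax

lemma sum_sum_mul_bilin_nonpos {ι E : Type*} [Fintype ι] [AddCommGroup E] [Module ℝ E]
    {A : Matrix ι ι ℝ} (hA : A.PosSemidef) {D : LinearMap.BilinForm ℝ E} (hD : ∀ u, D u u ≤ 0)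
    (v : ι → E) : ∑ i, ∑ j, A i j * D (v i) (v j) ≤ 0 := by
  classical
  open scoped MatrixOrder in
  obtain ⟨B, rfl⟩ := CStarAlgebra.nonneg_iff_eq_star_mul_self.mp hA.nonneg
  calc ∑ i, ∑ j, (star B * B) i j * D (v i) (v j)
      = ∑ i, ∑ j, ∑ k, B k i * B k j * D (v i) (v j) := by
        simp [Matrix.mul_apply, Matrix.star_apply, Finset.sum_mul]
    _ = ∑ i, ∑ k, ∑ j, B k i * B k j * D (v i) (v j) :=
        Finset.sum_congr rfl fun i _ => Finset.sum_comm
    _ = ∑ k, ∑ i, ∑ j, B k i * B k j * D (v i) (v j) := Finset.sum_comm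
    _ = ∑ k, D (∑ i, B k i • v i) (∑ i, B k i • v i) :=
        Finset.sum_congr rfl fun k _ => by
          rw [Finset.sum_comm]
          simp [map_sum, Finset.mul_sum, mul_assoc, mul_left_comm]
    _ ≤ 0 := Finset.sum_nonpos fun k _ => hD _

variable {n : ℕ} {e : Fin n → EuclideanSpace ℝ (Fin n) → EuclideanSpace ℝ (Fin n)}
  {A : EuclideanSpace ℝ (Fin n) → Matrix (Fin n) (Fin n) ℝ}
  {V W : EuclideanSpace ℝ (Fin n) → EuclideanSpace ℝ (Fin n)}
  {f g s : EuclideanSpace ℝ (Fin n) → ℝ} {x : EuclideanSpace ℝ (Fin n)}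

lemma contDiffAt_fieldDeriv (hV : ContDiffAt ℝ ∞ V x) (hf : ContDiffAt ℝ ∞ f x) :
    ContDiffAt ℝ ∞ (fieldDeriv V f) x :=
  contDiffAt_lieDeriv hV hf

lemma contDiffAt_frameGradient (he : ∀ i, ContDiffAt ℝ ∞ (e i) x) (hf : ContDiffAt ℝ ∞ f x) :
    ContDiffAt ℝ ∞ (frameGradient e f) x :=
  contDiffAt_pi.mpr fun i => contDiffAt_fieldDeriv (he i) hf

lemma fieldDeriv_congr (h : f =ᶠ[𝓝 x] g) : fieldDeriv V f x = fieldDeriv V g x := by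
  simp only [fieldDeriv, h.fderiv_eq]

lemma fieldDeriv_add_smul (hf : DifferentiableAt ℝ f x) (hg : DifferentiableAt ℝ g x) (c : ℝ) :
    fieldDeriv V (f + c • g) x = fieldDeriv V f x + c * fieldDeriv V g x := by
  simp [fieldDeriv, fderiv_add hf (hg.const_smul c), fderiv_const_smul hg]

lemma fieldDeriv_mul (hf : DifferentiableAt ℝ f x) (hg : DifferentiableAt ℝ g x) :
    fieldDeriv V (f * g) x = f x * fieldDeriv V g x + g x * fieldDeriv V f x := by
  simp [fieldDeriv, fderiv_mul hf hg]

lemma frameGradient_add_smul (hf : DifferentiableAt ℝ f x) (hg : DifferentiableAt ℝ g x) (c : ℝ) :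
    frameGradient e (f + c • g) x = frameGradient e f x + c • frameGradient e g x := by
  ext i
  exact fieldDeriv_add_smul hf hg c

lemma frameGradient_sub (hf : DifferentiableAt ℝ f x) (hg : DifferentiableAt ℝ g x) :
    frameGradient e (f - g) x = frameGradient e f x - frameGradient e g x := by
  simpa [sub_eq_add_neg] using frameGradient_add_smul (e := e) hf hg (-1)

lemma frameGradient_eq_zero_of_isLocalMax (hmax : IsLocalMax f x) : frameGradient e f x = 0 := by
  ext i
  simp [frameGradient, fieldDeriv, hmax.fderiv_eq_zero]

lemma fieldDeriv_fieldDeriv_add_smul (hW : ContDiffAt ℝ ∞ W x) (hf : ContDiffAt ℝ ∞ f x)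
    (hg : ContDiffAt ℝ ∞ g x) (c : ℝ) :
    fieldDeriv V (fieldDeriv W (f + c • g)) x
      = fieldDeriv V (fieldDeriv W f) x + c * fieldDeriv V (fieldDeriv W g) x := by
  have h : fieldDeriv W (f + c • g) =ᶠ[𝓝 x] fieldDeriv W f + c • fieldDeriv W g := by
    filter_upwards [(hf.of_le (m := 1) (by simp)).eventually (by simp),
      (hg.of_le (m := 1) (by simp)).eventually (by simp)] with z hz₁ hz₂
    exact fieldDeriv_add_smul (hz₁.differentiableAt (by simp)) (hz₂.differentiableAt (by simp)) c
  rw [fieldDeriv_congr h, fieldDeriv_add_smul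
    ((contDiffAt_fieldDeriv hW hf).differentiableAt (by simp))
    ((contDiffAt_fieldDeriv hW hg).differentiableAt (by simp))]

lemma secondOrderPart_add_smul (he : ∀ i, ContDiffAt ℝ ∞ (e i) x) (hf : ContDiffAt ℝ ∞ f x)
    (hg : ContDiffAt ℝ ∞ g x) (c : ℝ) :
    secondOrderPart e A (f + c • g) x = secondOrderPart e A f x + c * secondOrderPart e A g x := by
  simp only [secondOrderPart, fieldDeriv_fieldDeriv_add_smul (he _) hf hg, mul_add,
    Finset.sum_add_distrib, Finset.mul_sum, mul_left_comm]

lemma secondOrderPart_sub (he : ∀ i, ContDiffAt ℝ ∞ (e i) x) (hf : ContDiffAt ℝ ∞ f x)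
    (hg : ContDiffAt ℝ ∞ g x) :
    secondOrderPart e A (f - g) x = secondOrderPart e A f x - secondOrderPart e A g x := by
  simpa [sub_eq_add_neg] using secondOrderPart_add_smul (A := A) he hf hg (-1)

lemma fieldDeriv_fieldDeriv_eq_of_isLocalMax (hW : DifferentiableAt ℝ W x) (hf : ContDiffAt ℝ 2 f x)
    (hmax : IsLocalMax f x) :
    fieldDeriv V (fieldDeriv W f) x = fderiv ℝ (fderiv ℝ f) x (V x) (W x) := by
  have hdf := (hf.fderiv_right (m := 1) (by norm_num)).differentiableAt (by simp)
  change fderiv ℝ (fun z => fderiv ℝ f z (W z)) x (V x) = _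
  rw [fderiv_clm_apply hdf hW, hmax.fderiv_eq_zero]
  simp

lemma secondOrderPart_nonpos_of_isLocalMax (he : ∀ i, DifferentiableAt ℝ (e i) x)
    (hA : (A x).PosSemidef) (hf : ContDiffAt ℝ 2 f x) (hmax : IsLocalMax f x) :
    secondOrderPart e A f x ≤ 0 := by
  simp only [secondOrderPart, fieldDeriv_fieldDeriv_eq_of_isLocalMax (he _) hf hmax]
  exact sum_sum_mul_bilin_nonpos hA (D := (fderiv ℝ (fderiv ℝ f) x).toBilinForm)
    (fderiv_fderiv_nonpos_of_isLocalMax hf hmax) fun i => e i x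

lemma fieldDeriv_add_smul_sq (hs : DifferentiableAt ℝ s x) (K : ℝ) :
    fieldDeriv V (s + K • (s * s)) x = (1 + 2 * K * s x) * fieldDeriv V s x := by
  rw [fieldDeriv_add_smul hs (hs.mul hs), fieldDeriv_mul hs hs]
  ring

lemma fieldDeriv_fieldDeriv_add_smul_sq (hV : ContDiffAt ℝ ∞ V x) (hs : ContDiffAt ℝ ∞ s x)
    (hs₀ : s x = 0) (K : ℝ) :
    fieldDeriv V (fieldDeriv V (s + K • (s * s))) x
      = 2 * K * fieldDeriv V s x ^ 2 + fieldDeriv V (fieldDeriv V s) x := by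
  have hmul : fieldDeriv V (s * s) =ᶠ[𝓝 x] fieldDeriv V s * s + (1 : ℝ) • (s * fieldDeriv V s) := by
    filter_upwards [(hs.of_le (m := 1) (by simp)).eventually (by simp)] with z hz
    simp [fieldDeriv_mul (hz.differentiableAt (by simp)) (hz.differentiableAt (by simp)), mul_comm]
  have hd := hs.differentiableAt (by simp)
  have hd' := (contDiffAt_fieldDeriv hV hs).differentiableAt (by simp)
  rw [fieldDeriv_fieldDeriv_add_smul hV hs (g := s * s) (hs.mul hs), fieldDeriv_congr hmul,
    fieldDeriv_add_smul (hd'.mul hd) (hd.mul hd'), fieldDeriv_mul hd' hd, fieldDeriv_mul hd hd',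
    hs₀]
  ring

end SecondOrder

section Linearization

open Set Filter Topology Asymptotics

lemma isBigO_sub_of_contDiffAt {E F G : Type*} [NormedAddCommGroup E] [NormedSpace ℝ E]
    [NormedAddCommGroup F] [NormedSpace ℝ F] [NormedAddCommGroup G] [NormedSpace ℝ G]
    {f : E × F → G} {x₀ : E} {y₀ : F} (hf : ContDiffAt ℝ 1 f (x₀, y₀)) {u v : E → F}
    (hu : Tendsto u (𝓝 x₀) (𝓝 y₀)) (hv : Tendsto v (𝓝 x₀) (𝓝 y₀)) :
    (fun x => f (x, u x) - f (x, v x)) =O[𝓝 x₀] fun x => u x - v x := by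
  have huv : Tendsto (fun x => ((x, u x), (x, v x))) (𝓝 x₀) (𝓝 ((x₀, y₀), (x₀, y₀))) :=
    (tendsto_id.prodMk_nhds hu).prodMk_nhds (tendsto_id.prodMk_nhds hv)
  refine ((hf.hasStrictFDerivAt one_ne_zero).isBigO_sub.comp_tendsto huv).trans ?_
  exact IsBigO.of_bound 1 (.of_forall fun x => by simp [Prod.norm_def])

lemma norm_prodMk_sub_sup_le {F : Type*} [NormedAddCommGroup F] (s t : ℝ) (p q : F) :
    ‖(s, p) - (s ⊔ t, q)‖ ≤ (s - t)⁻ + ‖p - q‖ := by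
  have : ‖s - s ⊔ t‖ = (s - t)⁻ := by
    rw [Real.norm_eq_abs, abs_sub_comm, abs_of_nonneg (sub_nonneg.mpr le_sup_left), negPart_def,
      neg_sub, ← max_sub_sub_right, sub_self, max_comm]
  rw [Prod.mk_sub_mk, Prod.norm_mk, this]
  exact max_le_add_of_nonneg (negPart_nonneg _) (norm_nonneg _)

variable {n : ℕ} {Ω : Set (EuclideanSpace ℝ (Fin n))} {x₀ : EuclideanSpace ℝ (Fin n)}
  {e : Fin n → EuclideanSpace ℝ (Fin n) → EuclideanSpace ℝ (Fin n)}
  {a : EuclideanSpace ℝ (Fin n) → (Fin n → ℝ) → Matrix (Fin n) (Fin n) ℝ}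
  {b : EuclideanSpace ℝ (Fin n) → ℝ → (Fin n → ℝ) → ℝ}
  {A : EuclideanSpace ℝ (Fin n) → Matrix (Fin n) (Fin n) ℝ}
  {φ ψ w : EuclideanSpace ℝ (Fin n) → ℝ}

/-- The differential inequality `A^{ij} eᵢ eⱼ w ≥ -K (w⁻ + |(e₁w, …, eₙw)|)` near `x₀`. It retains
from `Qψ ≤ Qφ` all that the maximum principle for `w = φ - ψ` needs. -/
def IsSubsolutionNear (e : Fin n → EuclideanSpace ℝ (Fin n) → EuclideanSpace ℝ (Fin n))
    (A : EuclideanSpace ℝ (Fin n) → Matrix (Fin n) (Fin n) ℝ)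
    (w : EuclideanSpace ℝ (Fin n) → ℝ) (x₀ : EuclideanSpace ℝ (Fin n)) : Prop :=
  ∃ K : ℝ, 0 ≤ K ∧ ∀ᶠ x in 𝓝 x₀, -(K * ((w x)⁻ + ‖frameGradient e w x‖)) ≤ secondOrderPart e A w x

/-- The expression `a^{ij}(x, p) eᵢ eⱼ ψ(x) + b(x, z, p)`, i.e. `Qψ(x)` with the arguments
`ψ(x)` and `(e₁ψ(x), …, eₙψ(x))` of the coefficients replaced by free variables `z` and `p`. -/
noncomputable def unfrozenOp (e : Fin n → EuclideanSpace ℝ (Fin n) → EuclideanSpace ℝ (Fin n))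
    (a : EuclideanSpace ℝ (Fin n) → (Fin n → ℝ) → Matrix (Fin n) (Fin n) ℝ)
    (b : EuclideanSpace ℝ (Fin n) → ℝ → (Fin n → ℝ) → ℝ) (ψ : EuclideanSpace ℝ (Fin n) → ℝ)
    (q : EuclideanSpace ℝ (Fin n) × ℝ × (Fin n → ℝ)) : ℝ :=
  secondOrderPart e (fun x => a x q.2.2) ψ q.1 + b q.1 q.2.1 q.2.2

lemma contDiffAt_unfrozenOp {z₀ : ℝ} {p₀ : Fin n → ℝ} (he : ∀ i, ContDiffAt ℝ ∞ (e i) x₀)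
    (ha : ∀ i j, ContDiffAt ℝ ∞ (fun q : EuclideanSpace ℝ (Fin n) × (Fin n → ℝ) => a q.1 q.2 i j)
      (x₀, p₀))
    (hb : ContDiffAt ℝ ∞ (fun q : EuclideanSpace ℝ (Fin n) × ℝ × (Fin n → ℝ) =>
      b q.1 q.2.1 q.2.2) (x₀, z₀, p₀))
    (hψ : ContDiffAt ℝ ∞ ψ x₀) : ContDiffAt ℝ ∞ (unfrozenOp e a b ψ) (x₀, z₀, p₀) := by
  refine ContDiffAt.add (ContDiffAt.sum fun i _ => ContDiffAt.sum fun j _ => ?_) hb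
  refine ContDiffAt.mul ?_ ?_
  · exact (ha i j).comp (x₀, z₀, p₀) (contDiffAt_fst.prodMk contDiffAt_snd.snd)
  · exact (contDiffAt_fieldDeriv (he i) (contDiffAt_fieldDeriv (he j) hψ)).comp (x₀, z₀, p₀)
      contDiffAt_fst

/-- Comparing `Qψ` with the values of `unfrozenOp` at `(ψ ⊔ φ, ∇ψ)` and `(φ, ∇φ)` replaces the
two-sided Lipschitz bound in `z` by one that only sees the negative part of `φ - ψ`. -/
lemma isSubsolutionNear_sub (hΩ : IsOpen Ω) (hx₀ : x₀ ∈ Ω) (he : ∀ i, ContDiffOn ℝ ∞ (e i) Ω)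
    (ha : ∀ i j, ContDiffAt ℝ ∞ (fun q : EuclideanSpace ℝ (Fin n) × (Fin n → ℝ) => a q.1 q.2 i j)
      (x₀, frameGradient e φ x₀))
    (hb : ContDiffAt ℝ ∞ (fun q : EuclideanSpace ℝ (Fin n) × ℝ × (Fin n → ℝ) =>
      b q.1 q.2.1 q.2.2) (x₀, φ x₀, frameGradient e φ x₀))
    (hb_mono : ∀ x ∈ Ω, ∀ p, Antitone fun z => b x z p)
    (hφ : ContDiffOn ℝ ∞ φ Ω) (hψ : ContDiffOn ℝ ∞ ψ Ω)
    (hQ : ∀ x ∈ Ω, frameQuasilinearOp e a b ψ x ≤ frameQuasilinearOp e a b φ x)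
    (hle : ψ x₀ ≤ φ x₀) (hgrad : frameGradient e ψ x₀ = frameGradient e φ x₀) :
    IsSubsolutionNear e (frozenCoeff e a φ) (φ - ψ) x₀ := by
  have smoothAt {x} (hx : x ∈ Ω) {F : Type} [NormedAddCommGroup F] [NormedSpace ℝ F]
      {f : EuclideanSpace ℝ (Fin n) → F} (hf : ContDiffOn ℝ ∞ f Ω) : ContDiffAt ℝ ∞ f x :=
    hf.contDiffAt (hΩ.mem_nhds hx)
  have he₀ i := smoothAt hx₀ (he i)
  have cφ := (smoothAt hx₀ hφ).continuousAt.tendsto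
  have c_max : Tendsto (fun x => φ x ⊔ ψ x) (𝓝 x₀) (𝓝 (φ x₀)) := by
    simpa [hle] using cφ.sup_nhds (smoothAt hx₀ hψ).continuousAt.tendsto
  have cgφ := (contDiffAt_frameGradient he₀ (smoothAt hx₀ hφ)).continuousAt.tendsto
  have cgψ := (contDiffAt_frameGradient he₀ (smoothAt hx₀ hψ)).continuousAt.tendsto
  rw [hgrad] at cgψ
  obtain ⟨K, hK, hbound⟩ := (isBigO_sub_of_contDiffAt
    ((contDiffAt_unfrozenOp he₀ ha hb (smoothAt hx₀ hψ)).of_le (by simp))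
    (cφ.prodMk_nhds cgφ) (c_max.prodMk_nhds cgψ)).exists_nonneg
  refine ⟨K, hK, ?_⟩
  filter_upwards [hbound.bound, hΩ.mem_nhds hx₀] with x hx hxΩ
  have hφx := smoothAt hxΩ hφ
  have hψx := smoothAt hxΩ hψ
  have hmono : unfrozenOp e a b ψ (x, φ x ⊔ ψ x, frameGradient e ψ x)
      ≤ frameQuasilinearOp e a b ψ x :=
    add_le_add_right (hb_mono x hxΩ _ le_sup_right) _
  have hnorm : ‖(φ x, frameGradient e φ x) - (φ x ⊔ ψ x, frameGradient e ψ x)‖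
      ≤ ((φ - ψ) x)⁻ + ‖frameGradient e (φ - ψ) x‖ := by
    rw [frameGradient_sub (hφx.differentiableAt (by simp)) (hψx.differentiableAt (by simp))]
    exact norm_prodMk_sub_sup_le ..
  have hlip := (abs_le.mp (hx.trans (mul_le_mul_of_nonneg_left hnorm hK))).2
  have hsub := secondOrderPart_sub (A := frozenCoeff e a φ) (fun i => smoothAt hxΩ (he i)) hφx hψx
  have hφ_op : unfrozenOp e a b ψ (x, φ x, frameGradient e φ x)
      = frameQuasilinearOp e a b φ x - secondOrderPart e (frozenCoeff e a φ) (φ - ψ) x := by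
    rw [hsub, unfrozenOp, frameQuasilinearOp]
    simp only [secondOrderPart, frozenCoeff]
    ring
  linarith [hQ x hxΩ]

end Linearization

section MaximumPrinciple

open Set Filter Topology

lemma frequently_isLocalMax_add_smul {M : Type*} [TopologicalSpace M] [LocallyCompactSpace M]
    {w h : M → ℝ} {x₀ : M} (hw : ∀ᶠ x in 𝓝 x₀, ContinuousAt w x)
    (hh : ∀ᶠ x in 𝓝 x₀, ContinuousAt h x) (hmax : IsLocalMax w x₀) (h₀ : h x₀ = 0)
    (hneg : ∀ᶠ x in 𝓝 x₀, w x = w x₀ → x ≠ x₀ → h x < 0) :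
    ∃ᶠ z in 𝓝 x₀, ∃ ε : ℝ, 0 < ε ∧ IsLocalMax (w + ε • h) z ∧ w x₀ ≤ (w + ε • h) z := by
  rw [frequently_iff]
  intro U hU
  obtain ⟨C, hC, hCU, hCc⟩ := local_compact_nhds (inter_mem hU
    (hw.and <| hh.and <| (hmax.eventually_nhds.and hneg)))
  have hsep : ∀ᶠ ε in 𝓝 (0 : ℝ), ∀ y ∈ C \ interior C, 0 < ε → w y + ε * h y < w x₀ := by
    refine (hCc.diff isOpen_interior).eventually_forall_of_forall_eventually fun y hy => ?_
    obtain ⟨-, hwy, hhy, hmaxy, hnegy⟩ := hCU hy.1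
    rcases hmaxy.self_of_nhds.lt_or_eq with hlt | heq
    · have hcont : ContinuousAt (fun q : ℝ × M => w q.2 + q.1 * h q.2) (0, y) :=
        (hwy.comp continuousAt_snd).add (continuousAt_fst.mul (hhy.comp continuousAt_snd))
      filter_upwards [hcont.eventually_lt_const (by simpa using hlt)] with q hq _ using hq
    · have hne : y ≠ x₀ := fun h => hy.2 (h ▸ mem_interior_iff_mem_nhds.mpr hC)
      filter_upwards [continuousAt_snd.eventually hmaxy,
        continuousAt_snd.eventually (hhy.eventually_lt_const (hnegy heq hne))] with q hq₁ hq₂ hε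
      nlinarith
  obtain ⟨ε, hsepε, hε : 0 < ε⟩ :=
    ((hsep.filter_mono nhdsWithin_le_nhds).and (self_mem_nhdsWithin (s := Ioi (0 : ℝ)))).exists
  have hcont : ContinuousOn (w + ε • h) C := fun x hx =>
    ((hCU hx).2.1.add ((hCU hx).2.2.1.const_smul ε)).continuousWithinAt
  have hx₀C : x₀ ∈ C := mem_of_mem_nhds hC
  obtain ⟨z, hzC, hz⟩ := hCc.exists_isMaxOn ⟨x₀, hx₀C⟩ hcont
  have hge : w x₀ ≤ (w + ε • h) z := by simpa [h₀] using hz hx₀C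
  have hz_int : z ∈ interior C := by
    by_contra hz_int
    exact (hsepε z ⟨hzC, hz_int⟩ hε).not_ge hge
  exact ⟨z, (hCU hzC).1, ε, hε, hz.isLocalMax (mem_interior_iff_mem_nhds.mp hz_int), hge⟩

variable {n r : ℕ} {Ω : Set (EuclideanSpace ℝ (Fin n))} {x x₀ : EuclideanSpace ℝ (Fin n)}
  {e : Fin n → EuclideanSpace ℝ (Fin n) → EuclideanSpace ℝ (Fin n)}
  {A : EuclideanSpace ℝ (Fin n) → Matrix (Fin n) (Fin n) ℝ}
  {X : Fin r → EuclideanSpace ℝ (Fin n) → EuclideanSpace ℝ (Fin n)}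
  {Y : EuclideanSpace ℝ (Fin n) → EuclideanSpace ℝ (Fin n)}
  {w h s : EuclideanSpace ℝ (Fin n) → ℝ}

lemma secondOrderPart_le_of_isLocalMax_add_smul (he : ∀ i, ContDiffAt ℝ ∞ (e i) x)
    (hA : (A x).PosSemidef) (hw : ContDiffAt ℝ ∞ w x) (hh : ContDiffAt ℝ ∞ h x) {K ε : ℝ}
    (hK : 0 ≤ K) (hε : 0 < ε)
    (hsub : -(K * ((w x)⁻ + ‖frameGradient e w x‖)) ≤ secondOrderPart e A w x)
    (hmax : IsLocalMax (w + ε • h) x) (hnonneg : 0 ≤ (w + ε • h) x) :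
    secondOrderPart e A h x ≤ K * (|h x| + ‖frameGradient e h x‖) := by
  have hgrad : ‖frameGradient e w x‖ = ε * ‖frameGradient e h x‖ := by
    have := frameGradient_eq_zero_of_isLocalMax (e := e) hmax
    rw [frameGradient_add_smul (hw.differentiableAt (by simp)) (hh.differentiableAt (by simp)),
      add_eq_zero_iff_eq_neg] at this
    rw [this, norm_neg, norm_smul, Real.norm_of_nonneg hε.le]
  have hneg : (w x)⁻ ≤ ε * |h x| := by
    rw [negPart_def]
    refine sup_le ?_ (by positivity)
    calc -w x ≤ ε * h x := by simpa [neg_le_iff_add_nonneg'] using hnonneg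
      _ ≤ ε * |h x| := mul_le_mul_of_nonneg_left (le_abs_self _) hε.le
  have hmaxP := secondOrderPart_nonpos_of_isLocalMax (f := w + ε • h)
    (fun i => (he i).differentiableAt (by simp)) hA
    ((hw.add (hh.const_smul ε)).of_le (by norm_cast)) hmax
  rw [secondOrderPart_add_smul he hw hh] at hmaxP
  refine le_of_mul_le_mul_left ?_ hε
  calc ε * secondOrderPart e A h x
      ≤ K * ((w x)⁻ + ‖frameGradient e w x‖) := by linarith
    _ ≤ K * (ε * |h x| + ε * ‖frameGradient e h x‖) := by rw [hgrad]; gcongr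
    _ = ε * (K * (|h x| + ‖frameGradient e h x‖)) := by ring

lemma IsSubsolutionNear.exists_secondOrderPart_le (hΩ : IsOpen Ω) (hx₀ : x₀ ∈ Ω)
    (he : ∀ i, ContDiffOn ℝ ∞ (e i) Ω) (hA : ∀ x ∈ Ω, (A x).PosSemidef) (hw : ContDiffOn ℝ ∞ w Ω)
    (hsub : IsSubsolutionNear e A w x₀) (hmax : IsLocalMax w x₀) (hnonneg : 0 ≤ w x₀) :
    ∃ K : ℝ, ∀ h : EuclideanSpace ℝ (Fin n) → ℝ, ContDiffOn ℝ ∞ h Ω →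
      ContinuousAt (secondOrderPart e A h) x₀ → h x₀ = 0 →
      (∀ᶠ x in 𝓝 x₀, w x = w x₀ → x ≠ x₀ → h x < 0) →
      secondOrderPart e A h x₀ ≤ K * ‖frameGradient e h x₀‖ := by
  obtain ⟨K, hK, hsub⟩ := hsub
  refine ⟨K, fun h hh hhA h₀ hneg => ?_⟩
  have hev : ∀ᶠ x in 𝓝 x₀, x ∈ Ω := hΩ.mem_nhds hx₀
  have hfreq : ∃ᶠ x in 𝓝 x₀, secondOrderPart e A h x ≤ K * (|h x| + ‖frameGradient e h x‖) := by
    refine ((frequently_isLocalMax_add_smul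
      (hev.mono fun x hx => hw.continuousOn.continuousAt (hΩ.mem_nhds hx))
      (hev.mono fun x hx => hh.continuousOn.continuousAt (hΩ.mem_nhds hx)) hmax h₀
      hneg).and_eventually (hev.and hsub)).mono ?_
    rintro x ⟨⟨ε, hε, hx, hge⟩, hxΩ, hxsub⟩
    have hxn := hΩ.mem_nhds hxΩ
    exact secondOrderPart_le_of_isLocalMax_add_smul (fun i => (he i).contDiffAt hxn) (hA x hxΩ)
      (hw.contDiffAt hxn) (hh.contDiffAt hxn) hK hε hxsub hx (hnonneg.trans hge)
  have hn := hΩ.mem_nhds hx₀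
  have hbound : ContinuousAt (fun x => K * (|h x| + ‖frameGradient e h x‖)) x₀ :=
    continuousAt_const.mul ((hh.contDiffAt hn).continuousAt.abs.add
      (contDiffAt_frameGradient (fun i => (he i).contDiffAt hn)
        (hh.contDiffAt hn)).continuousAt.norm)
  by_contra! hlt
  refine hfreq ((hbound.eventually_lt hhA (by simpa [h₀] using hlt)).mono fun x hx => hx.not_ge)

lemma IsSumOfSquares.continuousAt_secondOrderPart (hX : IsSumOfSquares Ω e A X Y) (hΩ : IsOpen Ω)
    (hx₀ : x₀ ∈ Ω) (hh : ContDiffOn ℝ ∞ h Ω) : ContinuousAt (secondOrderPart e A h) x₀ := by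
  have hn := hΩ.mem_nhds hx₀
  have hh₀ := hh.contDiffAt hn
  have hsmooth : ContDiffAt ℝ ∞
      (fun x => ∑ k, fieldDeriv (X k) (fieldDeriv (X k) h) x + fieldDeriv Y h x) x₀ :=
    (ContDiffAt.sum fun k _ => contDiffAt_fieldDeriv ((hX.1 k).contDiffAt hn)
      (contDiffAt_fieldDeriv ((hX.1 k).contDiffAt hn) hh₀)).add
      (contDiffAt_fieldDeriv (hX.2.1.contDiffAt hn) hh₀)
  refine hsmooth.continuousAt.congr ?_
  filter_upwards [hn] with x hx using (hX.2.2 h hh x hx).symm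

lemma nonpos_of_forall_nat_mul_le {α β : ℝ} (h : ∀ k : ℕ, k * α ≤ β) : α ≤ 0 := by
  by_contra! hα
  obtain ⟨k, hk⟩ := exists_nat_gt (β / α)
  exact (h k).not_gt ((div_lt_iff₀ hα).mp hk)

/-- The estimate for `secondOrderPart` at `x₀` is applied to `s + K s²`: its gradient at `x₀` is
that of `s`, while `Xₖ²(s + K s²)` gains `2K (Xₖ s)²`, and `K` is arbitrary. -/
lemma IsSumOfSquares.fieldDeriv_eq_zero (hX : IsSumOfSquares Ω e A X Y) (hΩ : IsOpen Ω)
    (he : ∀ i, ContDiffOn ℝ ∞ (e i) Ω) (hA : ∀ x ∈ Ω, (A x).PosSemidef) (hx₀ : x₀ ∈ Ω)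
    (hw : ContDiffOn ℝ ∞ w Ω) (hsub : IsSubsolutionNear e A w x₀) (hmax : IsLocalMax w x₀)
    (hnonneg : 0 ≤ w x₀) (hs : ContDiffOn ℝ ∞ s Ω) (hs₀ : s x₀ = 0)
    (hneg : ∀ᶠ x in 𝓝 x₀, w x = w x₀ → x ≠ x₀ → s x < 0) (k : Fin r) :
    fieldDeriv (X k) s x₀ = 0 := by
  obtain ⟨C, hC⟩ := hsub.exists_secondOrderPart_le hΩ hx₀ he hA hw hmax hnonneg
  have hn := hΩ.mem_nhds hx₀
  have hs_at := hs.contDiffAt hn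
  have hs_diff := hs_at.differentiableAt (by simp)
  have hbound (K : ℕ) : K * (2 * ∑ k, fieldDeriv (X k) s x₀ ^ 2) ≤ C * ‖frameGradient e s x₀‖
      - (∑ k, fieldDeriv (X k) (fieldDeriv (X k) s) x₀ + fieldDeriv Y s x₀) := by
    have hh : ContDiffOn ℝ ∞ (s + (K : ℝ) • (s * s)) Ω := hs.add (contDiffOn_const.smul (hs.mul hs))
    have hh_neg : ∀ᶠ x in 𝓝 x₀, w x = w x₀ → x ≠ x₀ → (s + (K : ℝ) • (s * s)) x < 0 := by
      have hsmall : ∀ᶠ x in 𝓝 x₀, 0 < 1 + K * s x :=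
        (continuousAt_const.add (hs_at.continuousAt.const_mul (K : ℝ))).eventually_const_lt
          (by simp [hs₀])
      filter_upwards [hneg, hsmall] with x hx hpos hwx hne
      have := mul_neg_of_neg_of_pos (hx hwx hne) hpos
      simp only [Pi.add_apply, Pi.smul_apply, Pi.mul_apply, smul_eq_mul]
      linarith
    have hgrad : frameGradient e (s + (K : ℝ) • (s * s)) x₀ = frameGradient e s x₀ := by
      ext i
      simp [frameGradient, fieldDeriv_add_smul_sq hs_diff, hs₀]
    have := hC _ hh (hX.continuousAt_secondOrderPart hΩ hx₀ hh) (by simp [hs₀]) hh_neg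
    simp only [hX.2.2 _ hh x₀ hx₀, hgrad, fieldDeriv_add_smul_sq hs_diff, hs₀,
      fieldDeriv_fieldDeriv_add_smul_sq ((hX.1 _).contDiffAt hn) hs_at, Finset.sum_add_distrib,
      ← Finset.mul_sum] at this
    linarith
  have hsum : ∑ k, fieldDeriv (X k) s x₀ ^ 2 = 0 :=
    le_antisymm (by linarith [nonpos_of_forall_nat_mul_le hbound]) (by positivity)
  have := (Finset.sum_eq_zero_iff_of_nonneg fun _ _ => sq_nonneg _).mp hsum k (Finset.mem_univ k)
  exact pow_eq_zero_iff two_ne_zero |>.mp this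

/-- The set of points of `Ω` where `w` attains a nonnegative maximum over `Ω`; maxima propagate
along `V` when `V` is tangent to it. -/
def nonnegMaxSet (Ω : Set (EuclideanSpace ℝ (Fin n))) (w : EuclideanSpace ℝ (Fin n) → ℝ) :
    Set (EuclideanSpace ℝ (Fin n)) :=
  {x | x ∈ Ω ∧ IsMaxOn w Ω x ∧ 0 ≤ w x}

lemma inter_closure_nonnegMaxSet (hw : ContinuousOn w Ω) :
    Ω ∩ closure (nonnegMaxSet Ω w) = nonnegMaxSet Ω w := by
  refine subset_antisymm ?_ fun x hx => ⟨hx.1, subset_closure hx⟩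
  rintro x ⟨hx, hcl⟩
  obtain ⟨u, hu, hlim⟩ := mem_closure_iff_seq_limit.mp hcl
  have hwu : Tendsto (fun k => w (u k)) atTop (𝓝 (w x)) :=
    (hw x hx).tendsto.comp (tendsto_nhdsWithin_iff.mpr ⟨hlim, .of_forall fun k => (hu k).1⟩)
  exact ⟨hx, fun y hy => ge_of_tendsto' hwu fun k => (hu k).2.1 hy,
    ge_of_tendsto' hwu fun k => (hu k).2.2⟩

lemma IsSumOfSquares.isTangentTo (hX : IsSumOfSquares Ω e A X Y) (hΩ : IsOpen Ω)
    (he : ∀ i, ContDiffOn ℝ ∞ (e i) Ω) (hA : ∀ x ∈ Ω, (A x).PosSemidef) (hw : ContDiffOn ℝ ∞ w Ω)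
    (hsub : ∀ x ∈ nonnegMaxSet Ω w, IsSubsolutionNear e A w x) (k : Fin r) :
    IsTangentTo (X k) (nonnegMaxSet Ω w) := by
  intro x hx y hy
  have hs : ContDiff ℝ ∞ fun z => ‖x - y‖ ^ 2 - ‖z - y‖ ^ 2 - ‖z - x‖ ^ 2 :=
    (contDiff_const.sub ((contDiff_id.sub contDiff_const).norm_sq ℝ)).sub
      ((contDiff_id.sub contDiff_const).norm_sq ℝ)
  have hneg : ∀ᶠ z in 𝓝 x, w z = w x → z ≠ x → ‖x - y‖ ^ 2 - ‖z - y‖ ^ 2 - ‖z - x‖ ^ 2 < 0 := by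
    filter_upwards [hΩ.mem_nhds hx.1] with z hzΩ hz hne
    have hzF : z ∈ nonnegMaxSet Ω w :=
      ⟨hzΩ, fun u hu => (hx.2.1 hu).trans_eq hz.symm, hx.2.2.trans_eq hz.symm⟩
    have hle : ‖x - y‖ ≤ ‖z - y‖ := by
      rw [← dist_eq_norm, ← dist_eq_norm, dist_comm x, hy, dist_comm z]
      exact Metric.infDist_le_dist_of_mem hzF
    have hpos : 0 < ‖z - x‖ := norm_pos_iff.mpr (sub_ne_zero.mpr hne)
    nlinarith [pow_le_pow_left₀ (norm_nonneg _) hle 2, pow_pos hpos 2]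
  have hzero := hX.fieldDeriv_eq_zero hΩ he hA hx.1 hw (hsub x hx)
    (hx.2.1.isLocalMax (hΩ.mem_nhds hx.1)) hx.2.2 hs.contDiffOn (by simp) hneg k
  have hderiv : HasFDerivAt (fun z => ‖x - y‖ ^ 2 - ‖z - y‖ ^ 2 - ‖z - x‖ ^ 2)
      (-(2 • innerSL ℝ (x - y)) - 2 • innerSL ℝ (x - x)) x :=
    (((hasFDerivAt_id x).sub_const y).norm_sq.const_sub _).sub
      ((hasFDerivAt_id x).sub_const x).norm_sq
  rw [fieldDeriv, hderiv.fderiv] at hzero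
  rw [inner_sub_right, real_inner_comm x, real_inner_comm y]
  have : inner ℝ x (X k x) - inner ℝ y (X k x) = 0 := by simpa using hzero
  linarith

lemma LieSpan.contDiffOn_and_isTangentTo (hΩ : IsOpen Ω) {F : Set (EuclideanSpace ℝ (Fin n))}
    (hF : Ω ∩ closure F = F) (hX : ∀ k, ContDiffOn ℝ ∞ (X k) Ω) (hXF : ∀ k, IsTangentTo (X k) F)
    {Z : EuclideanSpace ℝ (Fin n) → EuclideanSpace ℝ (Fin n)} (hZ : LieSpan Ω X Z) :
    ContDiffOn ℝ ∞ Z Ω ∧ IsTangentTo Z F := by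
  have hFΩ : F ⊆ Ω := hF ▸ inter_subset_left
  have hFc : IsLocallyClosed F := ⟨Ω, closure F, hΩ, isClosed_closure, hF.symm⟩
  have smoothAt {V : EuclideanSpace ℝ (Fin n) → EuclideanSpace ℝ (Fin n)}
      (hV : ContDiffOn ℝ ∞ V Ω) x (hx : x ∈ F) : ContDiffAt ℝ ∞ V x :=
    hV.contDiffAt (hΩ.mem_nhds (hFΩ hx))
  induction hZ with
  | gen k => exact ⟨hX k, hXF k⟩
  | zero => exact ⟨contDiffOn_const, fun x _ y _ => inner_zero_left _⟩
  | add _ _ hV hW =>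
    refine ⟨hV.1.add hW.1, fun x hx y hy => ?_⟩
    rw [inner_add_left, hV.2 x hx y hy, hW.2 x hx y hy, add_zero]
  | smul hg _ hV =>
    refine ⟨hg.smul hV.1, fun x hx y hy => ?_⟩
    rw [real_inner_smul_left, hV.2 x hx y hy, mul_zero]
  | bracket _ _ hV hW =>
    refine ⟨?_, hV.2.lieBracket hW.2 hFc (smoothAt hV.1) (smoothAt hW.1)⟩
    exact fun x hx => ((hV.1.contDiffAt (hΩ.mem_nhds hx)).lieBracket_vectorField
      (hW.1.contDiffAt (hΩ.mem_nhds hx)) (by simp)).contDiffWithinAt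
  | congr hVW _ hV =>
    refine ⟨hV.1.congr fun x hx => (hVW hx).symm, fun x hx y hy => ?_⟩
    rw [← hVW (hFΩ hx), hV.2 x hx y hy]

theorem IsSumOfSquares.maxPropagates (hX : IsSumOfSquares Ω e A X Y) (hΩ : IsOpen Ω)
    (he : ∀ i, ContDiffOn ℝ ∞ (e i) Ω) (hA : ∀ x ∈ Ω, (A x).PosSemidef) (hw : ContDiffOn ℝ ∞ w Ω)
    (hsub : ∀ x ∈ nonnegMaxSet Ω w, IsSubsolutionNear e A w x) : MaxPropagates Ω X w := by
  rintro Z hZ I Γ hI hΓΩ hΓ ⟨t₀, ht₀, hmax, hnonneg⟩ t ht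
  have hF := inter_closure_nonnegMaxSet hw.continuousOn
  obtain ⟨hZs, hZF⟩ := hZ.contDiffOn_and_isTangentTo hΩ hF hX.1
    (hX.isTangentTo hΩ he hA hw hsub)
  exact (hZF.mem_of_isIntegralCurveOn hΩ hF
    (fun x hx => (hZs.contDiffAt (hΩ.mem_nhds hx.1)).of_le (by simp)) hI hΓΩ hΓ ht₀
    ⟨hΓΩ ht₀, hmax, hnonneg⟩ t ht).2.1

end MaximumPrinciple

section ConstantRank

open Matrix Polynomial

variable {ι : Type*} [Fintype ι] [DecidableEq ι] {A : Matrix ι ι ℝ}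

lemma exists_charpoly_eq_X_pow_mul (hA : A.IsHermitian) :
    ∃ q : ℝ[X], A.charpoly = X ^ (Fintype.card ι - A.rank) * q ∧ q.coeff 0 ≠ 0 := by
  refine ⟨∏ i with ¬hA.eigenvalues i = 0, (X - C (hA.eigenvalues i)), ?_, ?_⟩
  · have hcard : Finset.card {i | hA.eigenvalues i = 0} = Fintype.card ι - A.rank := by
      rw [hA.rank_eq_card_non_zero_eigs, Fintype.card_subtype, ← Finset.card_univ (α := ι),
        ← Finset.card_filter_add_card_filter_not (s := (Finset.univ : Finset ι))
          (fun i => hA.eigenvalues i = 0), Nat.add_sub_cancel]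
    have hzero : ∏ i with hA.eigenvalues i = 0, (X - C (hA.eigenvalues i))
        = X ^ (Fintype.card ι - A.rank) := by
      rw [← hcard, ← Finset.prod_const]
      refine Finset.prod_congr rfl fun i hi => ?_
      rw [(Finset.mem_filter.mp hi).2, map_zero, sub_zero]
    rw [← hzero, Finset.prod_filter_mul_prod_filter_not]
    exact hA.charpoly_eq
  · rw [coeff_zero_eq_eval_zero, eval_prod, Finset.prod_ne_zero_iff]
    intro i hi
    simpa using (Finset.mem_filter.mp hi).2

lemma charpoly_coeff_ne_zero (hA : A.IsHermitian) :
    A.charpoly.coeff (Fintype.card ι - A.rank) ≠ 0 := by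
  obtain ⟨q, hq, hq0⟩ := exists_charpoly_eq_X_pow_mul hA
  have := coeff_X_pow_mul q (Fintype.card ι - A.rank) 0
  rw [zero_add, ← hq] at this
  rwa [this]

lemma mul_eq_zero_of_pow_mul_eq_zero {M : Matrix ι ι ℝ} (hA : A.IsHermitian) :
    ∀ d : ℕ, A ^ d * M = 0 → A * M = 0
  | 0, h => by rw [show M = 0 by simpa using h, mul_zero]
  | 1, h => by simpa using h
  | d + 2, h => by
    refine mul_eq_zero_of_pow_mul_eq_zero hA (d + 1) ?_
    have hAA : Aᴴ * A * (A ^ d * M) = 0 := by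
      rw [hA.eq, ← h]
      simp only [← mul_assoc, pow_succ']
    rwa [conjTranspose_mul_self_mul_eq_zero, ← mul_assoc, ← pow_succ'] at hAA

/-- The orthogonal projection onto the kernel of a symmetric matrix whose kernel has dimension `d`,
written as a polynomial in the matrix: if the characteristic polynomial is `X ^ d * q` with
`q 0 ≠ 0`, it is `q A / q 0`. The sum has spare zero terms. -/
noncomputable def kernelProjection (d : ℕ) (A : Matrix ι ι ℝ) : Matrix ι ι ℝ :=
  (A.charpoly.coeff d)⁻¹ •
    ∑ k ∈ Finset.range (Fintype.card ι + 1), A.charpoly.coeff (k + d) • A ^ k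

lemma isHermitian_kernelProjection (d : ℕ) (hA : A.IsHermitian) :
    (kernelProjection d A).IsHermitian := by
  have hAt : Aᵀ = A := by simpa using hA.eq
  simp [IsHermitian, kernelProjection, conjTranspose_eq_transpose_of_trivial, transpose_smul,
    transpose_sum, transpose_pow, hAt]

lemma kernelProjection_eq_aeval {d : ℕ} {q : ℝ[X]} (hq : A.charpoly = X ^ d * q)
    (hq0 : q.coeff 0 ≠ 0) : kernelProjection d A = (q.coeff 0)⁻¹ • aeval A q := by
  have hdeg : q.natDegree < Fintype.card ι + 1 := by
    have hcard := A.charpoly_natDegree_eq_dim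
    rw [hq, natDegree_X_pow_mul _ fun h => hq0 (by simp [h])] at hcard
    omega
  have hcoeff : A.charpoly.coeff d = q.coeff 0 := by
    rw [hq, ← coeff_X_pow_mul q d 0, zero_add]
  rw [kernelProjection, aeval_eq_sum_range' hdeg, hcoeff]
  simp only [hq, coeff_X_pow_mul]

lemma mul_kernelProjection (hA : A.IsHermitian) :
    A * kernelProjection (Fintype.card ι - A.rank) A = 0 := by
  obtain ⟨q, hq, hq0⟩ := exists_charpoly_eq_X_pow_mul hA
  have hAq : A ^ (Fintype.card ι - A.rank) * aeval A q = 0 := by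
    have := aeval_self_charpoly A
    rwa [hq, map_mul, map_pow, aeval_X] at this
  rw [kernelProjection_eq_aeval hq hq0, mul_smul_comm, mul_eq_zero_of_pow_mul_eq_zero hA _ hAq,
    smul_zero]

lemma kernelProjection_mul (hA : A.IsHermitian) :
    kernelProjection (Fintype.card ι - A.rank) A * A = 0 := by
  have := congrArg conjTranspose (mul_kernelProjection hA)
  rwa [conjTranspose_mul, hA.eq, (isHermitian_kernelProjection _ hA).eq, conjTranspose_zero]
    at this

lemma exists_kernelProjection_eq_one_add_mul (hA : A.IsHermitian) :
    ∃ N, kernelProjection (Fintype.card ι - A.rank) A = 1 + N * A := by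
  obtain ⟨q, hq, hq0⟩ := exists_charpoly_eq_X_pow_mul hA
  have hdiv : aeval A q = aeval A q.divX * A + q.coeff 0 • 1 := by
    conv_lhs => rw [← divX_mul_X_add q]
    rw [map_add, map_mul, aeval_X, aeval_C, Algebra.algebraMap_eq_smul_one]
  refine ⟨(q.coeff 0)⁻¹ • aeval A q.divX, ?_⟩
  rw [kernelProjection_eq_aeval hq hq0, hdiv, smul_add, add_comm, smul_smul, inv_mul_cancel₀ hq0,
    one_smul, smul_mul_assoc]

lemma kernelProjection_mul_self (hA : A.IsHermitian) :
    kernelProjection (Fintype.card ι - A.rank) A * kernelProjection (Fintype.card ι - A.rank) A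
      = kernelProjection (Fintype.card ι - A.rank) A := by
  obtain ⟨N, hN⟩ := exists_kernelProjection_eq_one_add_mul hA
  nth_rewrite 1 [hN]
  rw [add_mul, one_mul, mul_assoc, mul_kernelProjection hA, mul_zero, add_zero]

lemma posDef_add_kernelProjection (hA : A.PosSemidef) :
    (A + kernelProjection (Fintype.card ι - A.rank) A).PosDef := by
  obtain ⟨N, hN⟩ := exists_kernelProjection_eq_one_add_mul hA.isHermitian
  have hP := isHermitian_kernelProjection (Fintype.card ι - A.rank) hA.isHermitian
  have hPP := kernelProjection_mul_self hA.isHermitian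
  set P := kernelProjection (Fintype.card ι - A.rank) A
  have hPs : P.PosSemidef := by
    have := posSemidef_conjTranspose_mul_self P
    rwa [hP.eq, hPP] at this
  refine PosDef.of_dotProduct_mulVec_pos (hA.isHermitian.add hP) fun {ξ} hξ => ?_
  rw [add_mulVec, dotProduct_add]
  have hA_nonneg := hA.dotProduct_mulVec_nonneg ξ
  have hP_nonneg := hPs.dotProduct_mulVec_nonneg ξ
  refine lt_of_le_of_ne (add_nonneg hA_nonneg hP_nonneg) fun h => hξ ?_
  have hAξ : A *ᵥ ξ = 0 := (hA.dotProduct_mulVec_zero_iff ξ).mp (by linarith)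
  have hPξ : P *ᵥ ξ = 0 := (hPs.dotProduct_mulVec_zero_iff ξ).mp (by linarith)
  rwa [hN, add_mulVec, one_mulVec, ← mulVec_mulVec, hAξ, mulVec_zero, add_zero] at hPξ

/-- If `L * Lᴴ = A + P`, then `B = (1 - P) * L` satisfies `B * Bᴴ = (1 - P) * (A + P) * (1 - P)`,
which collapses to `A` because `P` annihilates `A`. -/
lemma one_sub_kernelProjection_mul_mul_conjTranspose {L : Matrix ι ι ℝ} (hA : A.IsHermitian)
    (hL : L * Lᴴ = A + kernelProjection (Fintype.card ι - A.rank) A) :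
    ((1 - kernelProjection (Fintype.card ι - A.rank) A) * L) *
      ((1 - kernelProjection (Fintype.card ι - A.rank) A) * L)ᴴ = A := by
  have hP := isHermitian_kernelProjection (Fintype.card ι - A.rank) hA
  have hPP := kernelProjection_mul_self hA
  have hAP := mul_kernelProjection hA
  have hPA := kernelProjection_mul hA
  set P := kernelProjection (Fintype.card ι - A.rank) A
  calc ((1 - P) * L) * ((1 - P) * L)ᴴ
      = (1 - P) * (L * Lᴴ) * (1 - P) := by
        simp only [conjTranspose_mul, conjTranspose_sub, conjTranspose_one, hP.eq, mul_assoc]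
    _ = A := by
        rw [hL]
        simp [mul_add, sub_mul, mul_sub, hAP, hPA, hPP]

end ConstantRank

section SmoothFactorization

open Matrix

variable {E : Type*} [NormedAddCommGroup E] [NormedSpace ℝ E] {Ω : Set E} {s : WithTop ℕ∞}

lemma contDiffOn_matrix_mul {l m n : Type*} [Fintype m] {A : E → Matrix l m ℝ}
    {B : E → Matrix m n ℝ} (hA : ∀ i j, ContDiffOn ℝ s (fun x => A x i j) Ω)
    (hB : ∀ i j, ContDiffOn ℝ s (fun x => B x i j) Ω) (i : l) (j : n) :
    ContDiffOn ℝ s (fun x => (A x * B x) i j) Ω := by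
  simp only [mul_apply]
  exact ContDiffOn.sum fun k _ => (hA i k).mul (hB k j)

section Square

variable {ι : Type*} [Fintype ι] [DecidableEq ι] {A : E → Matrix ι ι ℝ}

lemma contDiffOn_matrix_pow (hA : ∀ i j, ContDiffOn ℝ s (fun x => A x i j) Ω) :
    ∀ (k : ℕ) (i j : ι), ContDiffOn ℝ s (fun x => (A x ^ k) i j) Ω
  | 0, i, j => by simpa only [pow_zero] using contDiffOn_const
  | k + 1, i, j => by
    simp only [pow_succ]
    exact contDiffOn_matrix_mul (contDiffOn_matrix_pow hA k) hA i j

lemma contDiffOn_mvPolynomial_eval {σ : Type*} {u : σ → E → ℝ}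
    (hu : ∀ i, ContDiffOn ℝ s (u i) Ω) (p : MvPolynomial σ ℝ) :
    ContDiffOn ℝ s (fun x => MvPolynomial.eval (fun i => u i x) p) Ω := by
  induction p using MvPolynomial.induction_on with
  | C c => simpa only [MvPolynomial.eval_C] using contDiffOn_const
  | add p q hp hq => simpa only [map_add] using hp.add hq
  | mul_X p i hp => simpa only [map_mul, MvPolynomial.eval_X] using hp.mul (hu i)

lemma contDiffOn_charpoly_coeff (hA : ∀ i j, ContDiffOn ℝ s (fun x => A x i j) Ω) (k : ℕ) :
    ContDiffOn ℝ s (fun x => (A x).charpoly.coeff k) Ω := by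
  refine (contDiffOn_mvPolynomial_eval (u := fun (ij : ι × ι) x => A x ij.1 ij.2)
    (fun ij => hA ij.1 ij.2) ((charpoly.univ ℝ ι).coeff k)).congr fun x _ => ?_
  exact (charpoly.univ_coeff_eval₂Hom ι (RingHom.id ℝ) (fun ij => A x ij.1 ij.2) k).symm

lemma contDiffOn_kernelProjection (hA : ∀ i j, ContDiffOn ℝ s (fun x => A x i j) Ω) {d : ℕ}
    (hd : ∀ x ∈ Ω, (A x).charpoly.coeff d ≠ 0) (i j : ι) :
    ContDiffOn ℝ s (fun x => kernelProjection d (A x) i j) Ω := by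
  simp only [kernelProjection, Matrix.smul_apply, Matrix.sum_apply, smul_eq_mul]
  exact ((contDiffOn_charpoly_coeff hA d).inv hd).mul (ContDiffOn.sum fun k _ =>
    (contDiffOn_charpoly_coeff hA _).mul (contDiffOn_matrix_pow hA k i j))

end Square

/-- The Schur complement of the top left entry of a matrix. -/
noncomputable def schurComplement {N : ℕ} (H : Matrix (Fin (N + 1)) (Fin (N + 1)) ℝ) :
    Matrix (Fin N) (Fin N) ℝ :=
  of fun i j => H i.succ j.succ - H i.succ 0 * H 0 j.succ / H 0 0

lemma posDef_schurComplement {N : ℕ} {H : Matrix (Fin (N + 1)) (Fin (N + 1)) ℝ}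
    (hH : H.PosDef) : (schurComplement H).PosDef := by
  let T : Matrix (Fin (N + 1)) (Fin N) ℝ :=
    of fun i j => Fin.cases (-(H 0 j.succ / H 0 0)) (fun k => (1 : Matrix _ _ ℝ) k j) i
  have hT_zero : ∀ j, T 0 j = -(H 0 j.succ / H 0 0) := fun j => rfl
  have hT_succ : ∀ i j : Fin N, T i.succ j = (1 : Matrix _ _ ℝ) i j := fun i j => rfl
  have hT : Function.Injective T.mulVec := fun ξ η h => by
    funext i
    simpa [mulVec, dotProduct, hT_succ, one_apply] using congrFun h i.succ
  convert hH.conjTranspose_mul_mul_same hT using 1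
  ext i j
  have h00 : H 0 0 ≠ 0 := hH.diag_pos.ne'
  have hsymm : H i.succ 0 = H 0 i.succ := by simpa using hH.isHermitian.apply 0 i.succ
  simp only [schurComplement, of_apply, mul_apply, conjTranspose_apply, star_trivial,
    Fin.sum_univ_succ, hT_zero, hT_succ, one_apply, ite_mul, mul_ite, one_mul, mul_one, zero_mul,
    mul_zero, Finset.sum_ite_eq', Finset.mem_univ, if_true, hsymm]
  field_simp
  ring

/-- One step of the Cholesky algorithm: the factor of `H` built from a factor `L` of the Schur
complement of `H`. -/
noncomputable def choleskyStep {N : ℕ} (H : Matrix (Fin (N + 1)) (Fin (N + 1)) ℝ)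
    (L : Matrix (Fin N) (Fin N) ℝ) : Matrix (Fin (N + 1)) (Fin (N + 1)) ℝ :=
  of (Fin.cons (Fin.cons (√(H 0 0)) 0) fun i => Fin.cons (H i.succ 0 / √(H 0 0)) (L i))

lemma choleskyStep_mul_conjTranspose {N : ℕ} {H : Matrix (Fin (N + 1)) (Fin (N + 1)) ℝ}
    {L : Matrix (Fin N) (Fin N) ℝ} (hH : H.PosDef) (hL : L * Lᴴ = schurComplement H) :
    choleskyStep H L * (choleskyStep H L)ᴴ = H := by
  have hsq : √(H 0 0) * √(H 0 0) = H 0 0 := Real.mul_self_sqrt hH.diag_pos.le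
  have hsqrt : √(H 0 0) ≠ 0 := (Real.sqrt_pos.mpr hH.diag_pos).ne'
  have hsymm : ∀ i j, H i j = H j i := fun i j => by simpa using hH.isHermitian.apply j i
  have hLL : ∀ i j, ∑ k, L i k * L j k = schurComplement H i j := fun i j => by
    rw [← hL]
    simp [mul_apply]
  ext i j
  cases i using Fin.cases with
  | zero =>
    cases j using Fin.cases with
    | zero => simpa [choleskyStep, mul_apply, Fin.sum_univ_succ] using hsq
    | succ j =>
      simp [choleskyStep, mul_apply, Fin.sum_univ_succ, hsymm 0, mul_div_left_comm √_, hsqrt]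
  | succ i =>
    cases j using Fin.cases with
    | zero => simp [choleskyStep, mul_apply, Fin.sum_univ_succ, hsqrt]
    | succ j =>
      simp [choleskyStep, mul_apply, Fin.sum_univ_succ, hLL, schurComplement, div_mul_div_comm,
        hsq, hsymm 0]

lemma contDiffOn_choleskyStep {N : ℕ} {H : E → Matrix (Fin (N + 1)) (Fin (N + 1)) ℝ}
    {L : E → Matrix (Fin N) (Fin N) ℝ} (hH : ∀ i j, ContDiffOn ℝ s (fun x => H x i j) Ω)
    (hpos : ∀ x ∈ Ω, 0 < H x 0 0) (hL : ∀ i j, ContDiffOn ℝ s (fun x => L x i j) Ω)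
    (i j : Fin (N + 1)) : ContDiffOn ℝ s (fun x => choleskyStep (H x) (L x) i j) Ω := by
  have hsqrt : ContDiffOn ℝ s (fun x => √(H x 0 0)) Ω := (hH 0 0).sqrt fun x hx => (hpos x hx).ne'
  cases i using Fin.cases with
  | zero =>
    cases j using Fin.cases with
    | zero => simpa [choleskyStep] using hsqrt
    | succ j => simpa [choleskyStep] using contDiffOn_const
  | succ i =>
    cases j using Fin.cases with
    | zero =>
      simp only [choleskyStep, of_apply, Fin.cons_succ, Fin.cons_zero]
      exact (hH i.succ 0).div hsqrt fun x hx => (Real.sqrt_pos.mpr (hpos x hx)).ne'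
    | succ j => simpa [choleskyStep] using hL i j

lemma exists_contDiffOn_cholesky : ∀ {N : ℕ} {H : E → Matrix (Fin N) (Fin N) ℝ},
    (∀ i j, ContDiffOn ℝ s (fun x => H x i j) Ω) → (∀ x ∈ Ω, (H x).PosDef) →
    ∃ L : E → Matrix (Fin N) (Fin N) ℝ, (∀ i j, ContDiffOn ℝ s (fun x => L x i j) Ω) ∧
      ∀ x ∈ Ω, L x * (L x)ᴴ = H x
  | 0, _, _, _ => ⟨0, fun i => i.elim0, fun _ _ => Subsingleton.elim _ _⟩
  | N + 1, H, hs, hH => by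
    have hpos : ∀ x ∈ Ω, 0 < H x 0 0 := fun x hx => (hH x hx).diag_pos
    obtain ⟨L, hL, hLH⟩ := exists_contDiffOn_cholesky (H := fun x => schurComplement (H x))
      (fun i j => (hs _ _).sub
        (((hs _ _).mul (hs _ _)).div (hs 0 0) fun x hx => (hpos x hx).ne'))
      fun x hx => posDef_schurComplement (hH x hx)
    exact ⟨fun x => choleskyStep (H x) (L x), contDiffOn_choleskyStep hs hpos hL,
      fun x hx => choleskyStep_mul_conjTranspose (hH x hx) (hLH x hx)⟩

lemma exists_contDiffOn_factor {N ρ : ℕ} {A : E → Matrix (Fin N) (Fin N) ℝ}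
    (hs : ∀ i j, ContDiffOn ℝ s (fun x => A x i j) Ω) (hA : ∀ x ∈ Ω, (A x).PosSemidef)
    (hρ : ∀ x ∈ Ω, (A x).rank = ρ) :
    ∃ B : E → Matrix (Fin N) (Fin N) ℝ, (∀ i j, ContDiffOn ℝ s (fun x => B x i j) Ω) ∧
      ∀ x ∈ Ω, B x * (B x)ᴴ = A x := by
  have hd : ∀ x ∈ Ω, Fintype.card (Fin N) - (A x).rank = N - ρ := fun x hx => by
    rw [hρ x hx, Fintype.card_fin]
  have hP := contDiffOn_kernelProjection hs (d := N - ρ) fun x hx =>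
    hd x hx ▸ charpoly_coeff_ne_zero (hA x hx).isHermitian
  obtain ⟨L, hL, hLL⟩ := exists_contDiffOn_cholesky
    (H := fun x => A x + kernelProjection (N - ρ) (A x)) (fun i j => (hs i j).add (hP i j))
    fun x hx => hd x hx ▸ posDef_add_kernelProjection (hA x hx)
  refine ⟨fun x => (1 - kernelProjection (N - ρ) (A x)) * L x,
    contDiffOn_matrix_mul (fun i j => contDiffOn_const.sub (hP i j)) hL, fun x hx => ?_⟩
  have hLLx := hLL x hx
  rw [← hd x hx] at hLLx ⊢
  exact one_sub_kernelProjection_mul_mul_conjTranspose (hA x hx).isHermitian hLLx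

end SmoothFactorization

section SumOfSquares

open Matrix

variable {n r : ℕ} {Ω : Set (EuclideanSpace ℝ (Fin n))} {x : EuclideanSpace ℝ (Fin n)}
  {e : Fin n → EuclideanSpace ℝ (Fin n) → EuclideanSpace ℝ (Fin n)}
  {A : EuclideanSpace ℝ (Fin n) → Matrix (Fin n) (Fin n) ℝ}
  {B : EuclideanSpace ℝ (Fin n) → Matrix (Fin n) (Fin r) ℝ}
  {f : EuclideanSpace ℝ (Fin n) → ℝ}

/-- The vector fields `Xₖ = ∑ᵢ Bᵢₖ eᵢ`. -/
noncomputable def factorField (e : Fin n → EuclideanSpace ℝ (Fin n) → EuclideanSpace ℝ (Fin n))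
    (B : EuclideanSpace ℝ (Fin n) → Matrix (Fin n) (Fin r) ℝ) (k : Fin r) :
    EuclideanSpace ℝ (Fin n) → EuclideanSpace ℝ (Fin n) :=
  fun x => ∑ i, B x i k • e i x

/-- The first order part `∑ₖ ∑ⱼ (Xₖ Bⱼₖ) eⱼ` of `∑ₖ Xₖ²`, where `Xₖ = factorField e B k`. -/
noncomputable def factorDrift (e : Fin n → EuclideanSpace ℝ (Fin n) → EuclideanSpace ℝ (Fin n))
    (B : EuclideanSpace ℝ (Fin n) → Matrix (Fin n) (Fin r) ℝ) :
    EuclideanSpace ℝ (Fin n) → EuclideanSpace ℝ (Fin n) :=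
  fun x => ∑ k, ∑ j, fieldDeriv (factorField e B k) (fun y => B y j k) x • e j x

lemma fieldDeriv_factorField (k : Fin r) :
    fieldDeriv (factorField e B k) f x = ∑ i, B x i k * fieldDeriv (e i) f x := by
  simp [fieldDeriv, factorField, map_sum]

lemma fieldDeriv_neg_factorDrift :
    fieldDeriv (-factorDrift e B) f x = -∑ k, ∑ j,
      fieldDeriv (factorField e B k) (fun y => B y j k) x * fieldDeriv (e j) f x := by
  simp [fieldDeriv, factorDrift, map_sum]

lemma fieldDeriv_fieldDeriv_factorField (k : Fin r)
    (hB : ∀ j, DifferentiableAt ℝ (fun y => B y j k) x)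
    (hf : ∀ j, DifferentiableAt ℝ (fieldDeriv (e j) f) x) :
    fieldDeriv (factorField e B k) (fieldDeriv (factorField e B k) f) x
      = ∑ i, ∑ j, B x i k * B x j k * fieldDeriv (e i) (fieldDeriv (e j) f) x
        + ∑ j, fieldDeriv (factorField e B k) (fun y => B y j k) x * fieldDeriv (e j) f x := by
  have hXf : fieldDeriv (factorField e B k) f
      = fun y => ∑ j, ((fun y => B y j k) * fieldDeriv (e j) f) y :=
    funext fun y => fieldDeriv_factorField k
  have hsum : fieldDeriv (factorField e B k) (fieldDeriv (factorField e B k) f) x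
      = ∑ j, fieldDeriv (factorField e B k) ((fun y => B y j k) * fieldDeriv (e j) f) x := by
    rw [hXf, fieldDeriv, fderiv_fun_sum fun j _ => (hB j).mul (hf j), _root_.sum_apply]
    rfl
  rw [hsum, Finset.sum_comm, ← Finset.sum_add_distrib]
  refine Finset.sum_congr rfl fun j _ => ?_
  rw [fieldDeriv_mul (hB j) (hf j), fieldDeriv_factorField k (f := fieldDeriv (e j) f),
    Finset.mul_sum, mul_comm (fieldDeriv (e j) f x)]
  congr 1
  exact Finset.sum_congr rfl fun i _ => by ring

lemma secondOrderPart_eq_sum_of_factor (hBA : B x * (B x)ᴴ = A x) :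
    secondOrderPart e A f x
      = ∑ k, ∑ i, ∑ j, B x i k * B x j k * fieldDeriv (e i) (fieldDeriv (e j) f) x := by
  simp only [secondOrderPart, ← hBA, Matrix.mul_apply, Matrix.conjTranspose_apply, star_trivial,
    Finset.sum_mul]
  exact (Finset.sum_congr rfl fun i _ => Finset.sum_comm).trans Finset.sum_comm

lemma isSumOfSquares_of_factor (hΩ : IsOpen Ω) (he : ∀ i, ContDiffOn ℝ ∞ (e i) Ω)
    (hB : ∀ i k, ContDiffOn ℝ ∞ (fun x => B x i k) Ω)
    (hBA : ∀ x ∈ Ω, B x * (B x)ᴴ = A x) :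
    IsSumOfSquares Ω e A (factorField e B) (-factorDrift e B) := by
  have hX : ∀ k, ContDiffOn ℝ ∞ (factorField e B k) Ω := fun k =>
    ContDiffOn.sum fun i _ => (hB i k).smul (he i)
  refine ⟨hX, ContDiffOn.neg (ContDiffOn.sum fun k _ => ContDiffOn.sum fun j _ =>
    ContDiffOn.smul (f := fieldDeriv _ _) (fun x hx => ?_) (he j)), fun f hf x hx => ?_⟩
  · have hx := hΩ.mem_nhds hx
    exact (contDiffAt_fieldDeriv ((hX k).contDiffAt hx)
      ((hB j k).contDiffAt hx)).contDiffWithinAt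
  · have hx' := hΩ.mem_nhds hx
    have hXX := fun k => fieldDeriv_fieldDeriv_factorField k
      (fun j => ((hB j k).contDiffAt hx').differentiableAt (by simp))
      fun j => (contDiffAt_fieldDeriv ((he j).contDiffAt hx')
        (hf.contDiffAt hx')).differentiableAt (by simp)
    rw [secondOrderPart_eq_sum_of_factor (hBA x hx), fieldDeriv_neg_factorDrift]
    simp only [hXX, Finset.sum_add_distrib, add_neg_cancel_right]

lemma exists_isSumOfSquares_of_rank_eq (hΩ : IsOpen Ω) (he : ∀ i, ContDiffOn ℝ ∞ (e i) Ω)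
    (hA : ∀ i j, ContDiffOn ℝ ∞ (fun x => A x i j) Ω) (hpos : ∀ x ∈ Ω, (A x).PosSemidef) {ρ : ℕ}
    (hρ : ∀ x ∈ Ω, (A x).rank = ρ) :
    ∃ (X : Fin n → EuclideanSpace ℝ (Fin n) → EuclideanSpace ℝ (Fin n))
      (Y : EuclideanSpace ℝ (Fin n) → EuclideanSpace ℝ (Fin n)), IsSumOfSquares Ω e A X Y := by
  obtain ⟨B, hB, hBA⟩ := exists_contDiffOn_factor hA hpos hρ
  exact ⟨_, _, isSumOfSquares_of_factor hΩ he hB hBA⟩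

end SumOfSquares

section Comparison

open Set

variable {n : ℕ} {Ω : Set (EuclideanSpace ℝ (Fin n))}
  {e : Fin n → EuclideanSpace ℝ (Fin n) → EuclideanSpace ℝ (Fin n)}
  {a : EuclideanSpace ℝ (Fin n) → (Fin n → ℝ) → Matrix (Fin n) (Fin n) ℝ}
  {b : EuclideanSpace ℝ (Fin n) → ℝ → (Fin n → ℝ) → ℝ} {φ ψ : EuclideanSpace ℝ (Fin n) → ℝ}

lemma posSemidef_of_sum_nonneg {ι : Type*} [Fintype ι] {A : Matrix ι ι ℝ}
    (hA : ∀ i j, A i j = A j i)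
    (hA' : ∀ ξ : ι → ℝ, 0 ≤ ∑ i, ∑ j, A i j * ξ i * ξ j) : A.PosSemidef := by
  refine .of_dotProduct_mulVec_nonneg (Matrix.IsHermitian.ext fun i j => hA j i) fun ξ => ?_
  simpa [dotProduct, Matrix.mulVec, Finset.mul_sum, mul_assoc, mul_left_comm] using hA' ξ

lemma contDiffOn_frozenCoeff (hΩ : IsOpen Ω) (he : ∀ i, ContDiffOn ℝ ∞ (e i) Ω)
    (ha : ∀ i j, ContDiffOn ℝ ∞
      (fun q : EuclideanSpace ℝ (Fin n) × (Fin n → ℝ) => a q.1 q.2 i j) (Ω ×ˢ univ))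
    (hφ : ContDiffOn ℝ ∞ φ Ω) (i j : Fin n) :
    ContDiffOn ℝ ∞ (fun x => frozenCoeff e a φ x i j) Ω := by
  have hgrad : ContDiffOn ℝ ∞ (frameGradient e φ) Ω := fun x hx =>
    (contDiffAt_frameGradient (fun i => (he i).contDiffAt (hΩ.mem_nhds hx))
      (hφ.contDiffAt (hΩ.mem_nhds hx))).contDiffWithinAt
  exact (ha i j).comp (contDiffOn_id.prodMk hgrad) fun _ hx => ⟨hx, mem_univ _⟩

lemma antitone_of_deriv_section_nonpos (hΩ : IsOpen Ω)
    (hb : ContDiffOn ℝ ∞ (fun q : EuclideanSpace ℝ (Fin n) × ℝ × (Fin n → ℝ) => b q.1 q.2.1 q.2.2)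
      (Ω ×ˢ univ)) {x : EuclideanSpace ℝ (Fin n)} (hx : x ∈ Ω) {p : Fin n → ℝ}
    (hb_mono : ∀ z, deriv (fun s => b x s p) z ≤ 0) : Antitone fun z => b x z p := by
  refine antitone_of_deriv_nonpos (fun z => ?_) hb_mono
  have hbz := (hb.contDiffAt ((hΩ.prod isOpen_univ).mem_nhds
    (mk_mem_prod hx (mem_univ (z, p))))).differentiableAt (by simp)
  exact hbz.comp (f := fun z : ℝ => (x, z, p)) z (by fun_prop)

lemma maxPropagates_sub (hΩ : IsOpen Ω) (he : ∀ i, ContDiffOn ℝ ∞ (e i) Ω)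
    (ha : ∀ i j, ContDiffOn ℝ ∞
      (fun q : EuclideanSpace ℝ (Fin n) × (Fin n → ℝ) => a q.1 q.2 i j) (Ω ×ˢ univ))
    (hb : ContDiffOn ℝ ∞ (fun q : EuclideanSpace ℝ (Fin n) × ℝ × (Fin n → ℝ) => b q.1 q.2.1 q.2.2)
      (Ω ×ˢ univ))
    (hpos : ∀ x ∈ Ω, (frozenCoeff e a φ x).PosSemidef)
    (hb_mono : ∀ x ∈ Ω, ∀ z p, deriv (fun s => b x s p) z ≤ 0)
    (hφ : ContDiffOn ℝ ∞ φ Ω) (hψ : ContDiffOn ℝ ∞ ψ Ω)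
    (hQ : ∀ x ∈ Ω, frameQuasilinearOp e a b ψ x ≤ frameQuasilinearOp e a b φ x) {r : ℕ}
    {X : Fin r → EuclideanSpace ℝ (Fin n) → EuclideanSpace ℝ (Fin n)}
    {Y : EuclideanSpace ℝ (Fin n) → EuclideanSpace ℝ (Fin n)}
    (hX : IsSumOfSquares Ω e (frozenCoeff e a φ) X Y) : MaxPropagates Ω X (φ - ψ) := by
  refine hX.maxPropagates hΩ he hpos (hφ.sub hψ) fun x ⟨hx, hmax, hnonneg⟩ => ?_
  have hx' := hΩ.mem_nhds hx
  have hdφ : DifferentiableAt ℝ φ x := (hφ.contDiffAt hx').differentiableAt (by simp)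
  have hdψ : DifferentiableAt ℝ ψ x := (hψ.contDiffAt hx').differentiableAt (by simp)
  have hgrad := frameGradient_eq_zero_of_isLocalMax (e := e) (hmax.isLocalMax hx')
  rw [frameGradient_sub hdφ hdψ, sub_eq_zero] at hgrad
  exact isSubsolutionNear_sub hΩ hx he
    (fun i j => (ha i j).contDiffAt ((hΩ.prod isOpen_univ).mem_nhds ⟨hx, mem_univ _⟩))
    (hb.contDiffAt ((hΩ.prod isOpen_univ).mem_nhds ⟨hx, mem_univ _⟩))
    (fun y hy p => antitone_of_deriv_section_nonpos hΩ hb hy fun z => hb_mono y hy z p) hφ hψ hQ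
    (sub_nonneg.mp hnonneg) hgrad.symm

theorem theoremA_general (hΩ : IsOpen Ω) (he : ∀ i, ContDiffOn ℝ ∞ (e i) Ω)
    (ha : ∀ i j, ContDiffOn ℝ ∞
      (fun q : EuclideanSpace ℝ (Fin n) × (Fin n → ℝ) => a q.1 q.2 i j) (Ω ×ˢ univ))
    (hb : ContDiffOn ℝ ∞ (fun q : EuclideanSpace ℝ (Fin n) × ℝ × (Fin n → ℝ) => b q.1 q.2.1 q.2.2)
      (Ω ×ˢ univ))
    (hb_mono : ∀ x ∈ Ω, ∀ z p, deriv (fun s => b x s p) z ≤ 0)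
    (hφ : ContDiffOn ℝ ∞ φ Ω) (hpos : ∀ x ∈ Ω, (frozenCoeff e a φ x).PosSemidef) :
    (∀ ψ : EuclideanSpace ℝ (Fin n) → ℝ, ContDiffOn ℝ ∞ ψ Ω →
      (∀ x ∈ Ω, frameQuasilinearOp e a b ψ x ≤ frameQuasilinearOp e a b φ x) →
      ∀ (r : ℕ) (X : Fin r → EuclideanSpace ℝ (Fin n) → EuclideanSpace ℝ (Fin n))
        (Y : EuclideanSpace ℝ (Fin n) → EuclideanSpace ℝ (Fin n)),
        IsSumOfSquares Ω e (frozenCoeff e a φ) X Y → MaxPropagates Ω X (fun x => φ x - ψ x)) ∧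
    (∀ ρ : ℕ, (∀ x ∈ Ω, (frozenCoeff e a φ x).rank = ρ) →
      ∃ (r : ℕ) (X : Fin r → EuclideanSpace ℝ (Fin n) → EuclideanSpace ℝ (Fin n))
        (Y : EuclideanSpace ℝ (Fin n) → EuclideanSpace ℝ (Fin n)),
        IsSumOfSquares Ω e (frozenCoeff e a φ) X Y ∧
        ∀ ψ : EuclideanSpace ℝ (Fin n) → ℝ, ContDiffOn ℝ ∞ ψ Ω →
          (∀ x ∈ Ω, frameQuasilinearOp e a b ψ x ≤ frameQuasilinearOp e a b φ x) →
          MaxPropagates Ω X (fun x => φ x - ψ x)) := by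
  refine ⟨fun ψ hψ hQ r X Y hX => maxPropagates_sub hΩ he ha hb hpos hb_mono hφ hψ hQ hX,
    fun ρ hρ => ?_⟩
  obtain ⟨X, Y, hX⟩ :=
    exists_isSumOfSquares_of_rank_eq hΩ he (contDiffOn_frozenCoeff hΩ he ha hφ) hpos hρ
  exact ⟨n, X, Y, hX, fun ψ hψ hQ => maxPropagates_sub hΩ he ha hb hpos hb_mono hφ hψ hQ hX⟩

end Comparison

/-- The four conjuncts: the comparison principle for `Q` under the sum-of-squares condition, its
moving frame version, and both with the sum-of-squares condition replaced by constant rank. -/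
theorem theoremA (m : ℕ) (hm : 1 ≤ m)
    (Ω : Set (EuclideanSpace ℝ (Fin (m + 1)))) (hΩ_open : IsOpen Ω) (hΩ_conn : IsConnected Ω)
    (a : EuclideanSpace ℝ (Fin (m + 1)) → (Fin (m + 1) → ℝ) →
      Matrix (Fin (m + 1)) (Fin (m + 1)) ℝ)
    (b : EuclideanSpace ℝ (Fin (m + 1)) → ℝ → (Fin (m + 1) → ℝ) → ℝ)
    (ha_smooth : ∀ i j, ContDiffOn ℝ ∞
      (fun q : EuclideanSpace ℝ (Fin (m + 1)) × (Fin (m + 1) → ℝ) => a q.1 q.2 i j)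
      (Ω ×ˢ Set.univ))
    (hb_smooth : ContDiffOn ℝ ∞
      (fun q : EuclideanSpace ℝ (Fin (m + 1)) × ℝ × (Fin (m + 1) → ℝ) => b q.1 q.2.1 q.2.2)
      (Ω ×ˢ Set.univ))
    (ha_symm : ∀ x ∈ Ω, ∀ p i j, a x p i j = a x p j i)
    (ha_nonneg : ∀ x ∈ Ω, ∀ p, ∀ ξ : Fin (m + 1) → ℝ, 0 ≤ ∑ i, ∑ j, a x p i j * ξ i * ξ j)
    (hb_mono : ∀ x ∈ Ω, ∀ z p, deriv (fun s => b x s p) z ≤ 0) :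
    (∀ φ ψ : EuclideanSpace ℝ (Fin (m + 1)) → ℝ,
      ContDiffOn ℝ ∞ φ Ω → ContDiffOn ℝ ∞ ψ Ω →
      (∀ x ∈ Ω, quasilinearOp a b ψ x ≤ quasilinearOp a b φ x) →
      ∀ (r : ℕ) (X : Fin r → EuclideanSpace ℝ (Fin (m + 1)) → EuclideanSpace ℝ (Fin (m + 1)))
        (Y : EuclideanSpace ℝ (Fin (m + 1)) → EuclideanSpace ℝ (Fin (m + 1))),
        IsSumOfSquares Ω (coordFrame (m + 1)) (frozenCoeff (coordFrame (m + 1)) a φ) X Y →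
        MaxPropagates Ω X (fun x => φ x - ψ x)) ∧
    (∀ e : Fin (m + 1) → EuclideanSpace ℝ (Fin (m + 1)) → EuclideanSpace ℝ (Fin (m + 1)),
      IsSmoothFrame Ω e →
      ∀ φ ψ : EuclideanSpace ℝ (Fin (m + 1)) → ℝ,
      ContDiffOn ℝ ∞ φ Ω → ContDiffOn ℝ ∞ ψ Ω →
      (∀ x ∈ Ω, frameQuasilinearOp e a b ψ x ≤ frameQuasilinearOp e a b φ x) →
      ∀ (r : ℕ) (X : Fin r → EuclideanSpace ℝ (Fin (m + 1)) → EuclideanSpace ℝ (Fin (m + 1)))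
        (Y : EuclideanSpace ℝ (Fin (m + 1)) → EuclideanSpace ℝ (Fin (m + 1))),
        IsSumOfSquares Ω e (frozenCoeff e a φ) X Y →
        MaxPropagates Ω X (fun x => φ x - ψ x)) ∧
    (∀ φ : EuclideanSpace ℝ (Fin (m + 1)) → ℝ, ContDiffOn ℝ ∞ φ Ω →
      ∀ ρ : ℕ, (∀ x ∈ Ω, (frozenCoeff (coordFrame (m + 1)) a φ x).rank = ρ) →
      ∃ (r : ℕ) (X : Fin r → EuclideanSpace ℝ (Fin (m + 1)) → EuclideanSpace ℝ (Fin (m + 1)))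
        (Y : EuclideanSpace ℝ (Fin (m + 1)) → EuclideanSpace ℝ (Fin (m + 1))),
        IsSumOfSquares Ω (coordFrame (m + 1)) (frozenCoeff (coordFrame (m + 1)) a φ) X Y ∧
        ∀ ψ : EuclideanSpace ℝ (Fin (m + 1)) → ℝ, ContDiffOn ℝ ∞ ψ Ω →
          (∀ x ∈ Ω, quasilinearOp a b ψ x ≤ quasilinearOp a b φ x) →
          MaxPropagates Ω X (fun x => φ x - ψ x)) ∧
    (∀ e : Fin (m + 1) → EuclideanSpace ℝ (Fin (m + 1)) → EuclideanSpace ℝ (Fin (m + 1)),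
      IsSmoothFrame Ω e →
      ∀ φ : EuclideanSpace ℝ (Fin (m + 1)) → ℝ, ContDiffOn ℝ ∞ φ Ω →
      ∀ ρ : ℕ, (∀ x ∈ Ω, (frozenCoeff e a φ x).rank = ρ) →
      ∃ (r : ℕ) (X : Fin r → EuclideanSpace ℝ (Fin (m + 1)) → EuclideanSpace ℝ (Fin (m + 1)))
        (Y : EuclideanSpace ℝ (Fin (m + 1)) → EuclideanSpace ℝ (Fin (m + 1))),
        IsSumOfSquares Ω e (frozenCoeff e a φ) X Y ∧
        ∀ ψ : EuclideanSpace ℝ (Fin (m + 1)) → ℝ, ContDiffOn ℝ ∞ ψ Ω →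
          (∀ x ∈ Ω, frameQuasilinearOp e a b ψ x ≤ frameQuasilinearOp e a b φ x) →
          MaxPropagates Ω X (fun x => φ x - ψ x)) := by
  have ha_pos : ∀ x ∈ Ω, ∀ p, (a x p).PosSemidef := fun x hx p =>
    posSemidef_of_sum_nonneg (ha_symm x hx p) (ha_nonneg x hx p)
  have hcoord : ∀ i, ContDiffOn ℝ ∞ (coordFrame (m + 1) i) Ω := fun _ => contDiffOn_const
  have main e he φ hφ := theoremA_general (e := e) (φ := φ) hΩ_open he ha_smooth hb_smooth hb_mono
    hφ fun x hx => ha_pos x hx _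
  exact ⟨fun φ ψ hφ => (main _ hcoord φ hφ).1 ψ, fun e he φ ψ hφ => (main e he.1 φ hφ).1 ψ,
    fun φ hφ => (main _ hcoord φ hφ).2, fun e he φ hφ => (main e he.1 φ hφ).2⟩
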